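/- Let $K$ be an algebraically closed field and $R=K[x_0,\dots,x_k]$. A camera $P:\mathbb P^k\dashrightarrow\mathbb P^{h}$ is an $(h+1)\times(k+1)$ matrix over $K$ of rank $h+1$; its center is the linear subspace $\mathbb P(\ker P)$. Let $h_1,h_2<k$ with $h_1+h_2=k+c$, where $c\ge 0$ is an integer, and let $P_1,P_2$ and $Q_1,Q_2$ be two pairs of cameras $P_i,Q_i:\mathbb P^k\dashrightarrow\mathbb P^{h_i}$. A profile is a pair $(\alpha_1,\alpha_2)$ of integers with $0\le\alpha_i\le h_i$ and $\alpha_1+\alpha_2=k+1$. Linear subspaces $L_i\subseteq\mathbb P^{h_i}$ (given by subspaces $\widehat L_i\subseteq K^{h_i+1}$) are corresponding for $P_1,P_2$ if there is a nonzero $y\in K^{k+1}$ with $P_iy\in\widehat L_i$ for $i=1,2$. The critical locus $\mathcal X\subseteq\mathbb P^k$ is the set of points $x$ that lie in the center of $Q_1$ or of $Q_2$, or are such that for every profile all subspaces $L_i$ of codimension $\alpha_i$ through $Q_i(x)$, $i=1,2$, are corresponding for $P_1,P_2$. Its ideal $I(\mathcal X)\subseteq R$ is the ideal generated by the Grassmann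 tensors $$\det\begin{pmatrix}P_1&S_1&0\\P_2&0&S_2\end{pmatrix},\qquad S_i=\bigl(Q_i(X)\mid S_i'\bigr),$$ for all profiles and all constant $(h_i+1)\times(h_i-\alpha_i)$ matrices $S'_i$, where $Q_i(X)$ is the column of linear forms $Q_i\cdot(x_0,\dots,x_k)^T$. Dimension and degree of $\mathcal X$ are those of the closed subscheme of $\mathbb P^k$ defined by $I(\mathcal X)$ (the degree being read off the leading coefficient of the Hilbert polynomial). A closed subscheme of $\mathbb P^k$ with homogeneous ideal $I$ is said to be of minimal degree if $I$ contains no nonzero linear form and the degree of the subscheme is its codimension plus one; for integral subschemes this is the classical notion of a variety of minimal degree. Assume that we are in the general case: no point of $\mathbb P^k$ is common to the centers of $P_1$ and $P_2$, or to the centers of $Q_1$ and $Q_2$, and $\mathcal X$ has the expected dimension $2k-h_1-h_2=k-c$. Then $\mathcal X$ is the zero locus of the homogeneous ideal $I(\mathcal X)$, this ideal is generated by the $2\times2$ minors of a $(c+1)\times2$ matrix of linear forms in $R$, and $\mathcal X$ has codimension $c$ and degree $c+1$; it is of minimal degree. -/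

import Mathlib

open MvPolynomial

noncomputable section

namespace Multiview

/-- A camera (linear projection) from `ℙ^k` to `ℙ^h`: an `(h+1) × (k+1)` matrix of
maximal rank `h+1`. -/
structure Camera (K : Type*) [Field K] (k h : ℕ) where
  mat : Matrix (Fin (h + 1)) (Fin (k + 1)) K
  rank_mat : mat.rank = h + 1

/-- The linear subspace of `K^{k+1}` whose projectivization is the center of projection. -/
def Camera.center {K : Type*} [Field K] {k h : ℕ} (P : Camera K k h) :
    Submodule K (Fin (k + 1) → K) :=
  LinearMap.ker P.mat.mulVecLin

/-- The column `Q(X)` of linear forms in the coordinates `X_0, …, X_k` of `ℙ^k`. -/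
def Camera.forms {K : Type*} [Field K] {k h : ℕ} (Q : Camera K k h) :
    Fin (h + 1) → MvPolynomial (Fin (k + 1)) K :=
  fun a => ∑ j, C (Q.mat a j) * X j

/-- A profile: codimensions `α_i` with `0 ≤ α_i ≤ h_i` and `∑ α_i = k + 1`. -/
def IsProfile {n : ℕ} (k : ℕ) (h α : Fin n → ℕ) : Prop :=
  (∀ i, α i ≤ h i) ∧ ∑ i, α i = k + 1

/-- Linear subspaces `L_i` of the views are corresponding for the cameras `P_i` if the closures
of their preimages have a common point `y` in `ℙ^k`. -/
def AreCorresponding {K : Type*} [Field K] {k n : ℕ} {h : Fin n → ℕ}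
    (P : ∀ i, Camera K k (h i)) (L : ∀ i, Submodule K (Fin (h i + 1) → K)) : Prop :=
  ∃ y : Fin (k + 1) → K, y ≠ 0 ∧ ∀ i, (P i).mat.mulVec y ∈ L i

/-- The critical locus of `Q_1, …, Q_n` with conjugate cameras `P_1, …, P_n`: the points `x` of
`ℙ^k` that lie in the center of some `Q_i`, or such that for every profile `α` all subspaces `L_i`
of codimension `α_i` through the images `Q_i(x)` are corresponding for the cameras `P_i`. -/
def criticalLocus {K : Type*} [Field K] {k n : ℕ} {h : Fin n → ℕ}
    (P Q : ∀ i, Camera K k (h i)) : Set (Projectivization K (Fin (k + 1) → K)) :=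
  {x | (∃ i, x.rep ∈ (Q i).center) ∨
    ∀ α : Fin n → ℕ, IsProfile k h α → ∀ L : ∀ i, Submodule K (Fin (h i + 1) → K),
      (∀ i, Module.finrank K (L i) + α i = h i + 1) →
      (∀ i, (Q i).mat.mulVec x.rep ∈ L i) → AreCorresponding P L}

/-- The block matrix whose determinant is the Grassmann tensor of the cameras `P_i`, evaluated at
the spans of the columns of matrices `S_i` with entries in the coordinate ring:
its `i`-th row block is `(P_i | 0 … S_i … 0)`. -/
def grassmannMatrix {K : Type*} [Field K] {k n : ℕ} {h : Fin n → ℕ} {τ : Fin n → Type}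
    (P : ∀ i, Camera K k (h i))
    (S : ∀ i, Matrix (Fin (h i + 1)) (τ i) (MvPolynomial (Fin (k + 1)) K)) :
    Matrix (Σ i, Fin (h i + 1)) (Fin (k + 1) ⊕ Σ i, τ i) (MvPolynomial (Fin (k + 1)) K) :=
  Matrix.fromCols (Matrix.of fun r j => C ((P r.1).mat r.2 j)) (Matrix.blockDiagonal' S)

/-- The matrix `S_i = (Q_i(X) | S'_i)` with `S'_i` a matrix of constants. -/
def spanMatrix {K : Type*} [Field K] {k h m : ℕ} (Q : Camera K k h)
    (S' : Matrix (Fin (h + 1)) (Fin m) K) :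
    Matrix (Fin (h + 1)) (Unit ⊕ Fin m) (MvPolynomial (Fin (k + 1)) K) :=
  Matrix.fromCols (Matrix.of fun a _ => Q.forms a) (S'.map C)

/-- The homogeneous ideal of the critical locus: it is generated by the Grassmann tensors of
`P_1, …, P_n` evaluated at the subspaces spanned by `Q_i(X)` and `h_i - α_i` further points, for
all profiles `α` and all choices of the further points. (The bijection `e` only identifies the
row and column index types; another choice changes the determinant by a sign. If the further
points are dependent, the determinant vanishes.) -/
def criticalIdeal {K : Type*} [Field K] {k n : ℕ} {h : Fin n → ℕ}
    (P Q : ∀ i, Camera K k (h i)) : Ideal (MvPolynomial (Fin (k + 1)) K) :=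
  Ideal.span {f | ∃ α : Fin n → ℕ, IsProfile k h α ∧
    ∃ S' : ∀ i, Matrix (Fin (h i + 1)) (Fin (h i - α i)) K,
    ∃ e : (Σ i, Fin (h i + 1)) ≃ (Fin (k + 1) ⊕ Σ i, (Unit ⊕ Fin (h i - α i))),
      f = ((grassmannMatrix P fun i => spanMatrix (Q i) (S' i)).submatrix id e).det}

/-- The closed subscheme of `ℙ^k` defined by the homogeneous ideal `I` has dimension `r`:
its affine cone has dimension `r + 1`. -/
def HasProjDim {K : Type*} [Field K] {k : ℕ} (I : Ideal (MvPolynomial (Fin (k + 1)) K))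
    (r : ℕ) : Prop :=
  ringKrullDim (MvPolynomial (Fin (k + 1)) K ⧸ I) = ((r + 1 : ℕ) : WithBot ℕ∞)

/-- The Hilbert function `d ↦ dim_K (R/I)_d`. -/
def hilbertFunction {K : Type*} [Field K] {k : ℕ} (I : Ideal (MvPolynomial (Fin (k + 1)) K))
    (d : ℕ) : ℕ :=
  Module.finrank K (homogeneousSubmodule (Fin (k + 1)) K d ⧸
    (I.restrictScalars K).comap (homogeneousSubmodule (Fin (k + 1)) K d).subtype)

/-- The closed subscheme of `ℙ^k` defined by the homogeneous ideal `I` has degree `e`: its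
dimension is some `r`, and its Hilbert polynomial has degree `r` and leading coefficient
`e / r!`. -/
def HasDegree {K : Type*} [Field K] {k : ℕ} (I : Ideal (MvPolynomial (Fin (k + 1)) K))
    (e : ℕ) : Prop :=
  ∃ (r : ℕ) (p : Polynomial ℚ), HasProjDim I r ∧
    (∀ᶠ d : ℕ in Filter.atTop, (hilbertFunction I d : ℚ) = p.eval (d : ℚ)) ∧
    p.natDegree = r ∧ p.leadingCoeff = (e : ℚ) / (r.factorial : ℚ)

/-- The closed subscheme of `ℙ^k` defined by the homogeneous ideal `I` is of minimal degree: it is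
contained in no hyperplane, and its degree is its codimension plus one. For a prime ideal
this is the classical notion of an (irreducible, reduced) variety of minimal degree. -/
structure IsMinimalDegree {K : Type*} [Field K] {k : ℕ}
    (I : Ideal (MvPolynomial (Fin (k + 1)) K)) : Prop where
  homogeneous : ∀ f ∈ I, ∀ d : ℕ, homogeneousComponent d f ∈ I
  nondegenerate : ∀ f ∈ I, f.IsHomogeneous 1 → f = 0
  degree_eq : ∃ r codim : ℕ, HasProjDim I r ∧ r + codim = k ∧ HasDegree I (codim + 1)

/-- The general case: no point is common to all the centers of the `P_i`, nor to all the centers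
of the `Q_i`, and the critical locus has the expected dimension `2 k - ∑ h_i`. -/
structure GeneralCase {K : Type*} [Field K] {k n : ℕ} {h : Fin n → ℕ}
    (P Q : ∀ i, Camera K k (h i)) : Prop where
  centers_left : ⨅ i, (P i).center = ⊥
  centers_right : ⨅ i, (Q i).center = ⊥
  expected_dim : ∃ r : ℕ, HasProjDim (criticalIdeal P Q) r ∧ r + ∑ i, h i = 2 * k

/-- The ideal generated by the `q × q` minors of an `m × q` matrix. -/
def maximalMinorsIdeal {R : Type*} [CommRing R] {m q : ℕ} (N : Matrix (Fin m) (Fin q) R) :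
    Ideal R :=
  Ideal.span (Set.range fun rows : Fin q → Fin m => (N.submatrix rows id).det)

end Multiview

end

/-! Stacking the two cameras P gives a (k+c+2) × (k+1) matrix, injective because their centers are
disjoint. Let A = (A_1 | A_2), with c+1 rows, be a basis of its left kernel. Row operations turn
each Grassmann tensor, up to a nonzero constant, into a (c+1) × (c+1) determinant with columns
A_1Q_1(X), A_2Q_2(X) and c-1 constant columns taken from the A_iS'_i. The first two columns put it
in the ideal of 2 × 2 minors of N = (A_1Q_1(X) | A_2Q_2(X)). Conversely each A_i is onto, because
the other camera has full rank; so the constant columns can be standard basis vectors, and every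
minor of N occurs (`criticalIdeal_eq_maximalMinorsIdeal`).

The degree comes from an explicit normal form. The affine cone has dimension r+1, so r+1 linear
equations cut it down to the origin (`exists_linear_parameters`). On a c-dimensional space of
solutions of these equations, N is a pencil of (c+1) × c matrices, injective everywhere on the
projective line, hence a single Kronecker block (`exists_chain`). In suitable linear coordinates y,
z the rows of N are therefore (z_i + a_i, z_{i-1}), where z_{-1} = b, z_c = 0, and the a_i and b are
linear in y (`exists_linearPencilIdeal_eq`). Then R/I is free over K[y] on 1, z_0, …, z_{c-1}
(`pencil_normal_form`): the minors rewrite each z_i z_j, and independence is seen by making the rows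
proportional to (t, 1), which sends z_i to a polynomial in t. The Hilbert function in degree d ≥ 1
is thus C(d+r, r) + c C(d-1+r, r), and the degree is c+1. An ideal generated by quadrics contains no
nonzero linear form.

For the zero locus, a Grassmann tensor vanishes at x exactly when its matrix has a kernel vector: a
common preimage of the chosen subspaces, or a dependency among the points spanning one of them. -/

noncomputable section

namespace Multiview

/-! ### Ideals of 2 × 2 minors and row operations -/

section MinorsTwoColumns

variable {R S : Type*} [CommRing R] [CommRing S] {m n : ℕ}

theorem minor_mem_maximalMinorsIdeal (N : Matrix (Fin m) (Fin 2) R) (i j : Fin m) :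
    N i 0 * N j 1 - N i 1 * N j 0 ∈ maximalMinorsIdeal N := by
  refine Ideal.subset_span ⟨![i, j], ?_⟩
  exact (Matrix.det_fin_two _).trans (by simp)

theorem maximalMinorsIdeal_le_iff (N : Matrix (Fin m) (Fin 2) R) (J : Ideal R) :
    maximalMinorsIdeal N ≤ J ↔ ∀ i j, N i 0 * N j 1 - N i 1 * N j 0 ∈ J := by
  refine ⟨fun h i j => h (minor_mem_maximalMinorsIdeal N i j), fun h => ?_⟩
  rw [maximalMinorsIdeal, Ideal.span_le]
  rintro _ ⟨rows, rfl⟩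
  simpa [Matrix.det_fin_two] using h (rows 0) (rows 1)

/-- Minors are bilinear in the two rows, so those of the product are combinations of those of `N`.
-/
theorem maximalMinorsIdeal_mul_le (L : Matrix (Fin n) (Fin m) R) (N : Matrix (Fin m) (Fin 2) R) :
    maximalMinorsIdeal (L * N) ≤ maximalMinorsIdeal N := by
  rw [maximalMinorsIdeal_le_iff]
  intro i j
  have : (L * N) i 0 * (L * N) j 1 - (L * N) i 1 * (L * N) j 0 =
      ∑ p, ∑ q, L i p * L j q * (N p 0 * N q 1 - N p 1 * N q 0) := by
    simp only [Matrix.mul_apply, Finset.sum_mul_sum, ← Finset.sum_sub_distrib]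
    refine Finset.sum_congr rfl fun p _ => Finset.sum_congr rfl fun q _ => by ring
  rw [this]
  exact Ideal.sum_mem _ fun p _ => Ideal.sum_mem _ fun q _ =>
    Ideal.mul_mem_left _ _ (minor_mem_maximalMinorsIdeal N p q)

theorem maximalMinorsIdeal_mul_eq (L L' : Matrix (Fin m) (Fin m) R) (hL : L' * L = 1)
    (N : Matrix (Fin m) (Fin 2) R) :
    maximalMinorsIdeal (L * N) = maximalMinorsIdeal N := by
  refine le_antisymm (maximalMinorsIdeal_mul_le L N) ?_
  have := maximalMinorsIdeal_mul_le L' (L * N)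
  rwa [← Matrix.mul_assoc, hL, Matrix.one_mul] at this

theorem map_mem_maximalMinorsIdeal {F : Type*} [FunLike F R S] [RingHomClass F R S] (f : F) {N : Matrix (Fin m) (Fin 2) R} {x : R}
    (hx : x ∈ maximalMinorsIdeal N) : f x ∈ maximalMinorsIdeal (N.map f) := by
  have : maximalMinorsIdeal N ≤ (maximalMinorsIdeal (N.map f)).comap f := by
    rw [maximalMinorsIdeal_le_iff]
    intro i j
    simpa using minor_mem_maximalMinorsIdeal (N.map f) i j
  exact this hx

end MinorsTwoColumns

/-! ### The Kronecker-type matrix with rows (z_i + a_i, z_{i-1}) -/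

section PencilMatrix

variable {R S : Type*} [CommRing R] [CommRing S] {c : ℕ}

/-- The `(c+1) × 2` matrix with rows `(z_i + a_i, z_{i-1})`, where `z_{-1} = b` and `z_c = 0`. -/
def pencilMatrix (z : Fin c → R) (a : Fin (c + 1) → R) (b : R) :
    Matrix (Fin (c + 1)) (Fin 2) R :=
  Matrix.of fun i =>
    ![Fin.snoc (α := fun _ => R) z 0 i + a i, Fin.cons (α := fun _ => R) b z i]

@[simp] theorem pencilMatrix_castSucc_zero (z : Fin c → R) (a : Fin (c + 1) → R) (b : R)
    (i : Fin c) : pencilMatrix z a b i.castSucc 0 = z i + a i.castSucc := by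
  simp [pencilMatrix]

@[simp] theorem pencilMatrix_last_zero (z : Fin c → R) (a : Fin (c + 1) → R) (b : R) :
    pencilMatrix z a b (Fin.last c) 0 = a (Fin.last c) := by
  simp [pencilMatrix]

@[simp] theorem pencilMatrix_zero_one (z : Fin c → R) (a : Fin (c + 1) → R) (b : R) :
    pencilMatrix z a b 0 1 = b := by
  simp [pencilMatrix]

@[simp] theorem pencilMatrix_succ_one (z : Fin c → R) (a : Fin (c + 1) → R) (b : R)
    (i : Fin c) : pencilMatrix z a b i.succ 1 = z i := by
  simp [pencilMatrix]

theorem pencilMatrix_map {F : Type*} [FunLike F R S] [RingHomClass F R S] (f : F) (z : Fin c → R) (a : Fin (c + 1) → R) (b : R) :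
    (pencilMatrix z a b).map f = pencilMatrix (f ∘ z) (f ∘ a) (f b) := by
  ext i j
  fin_cases j
  · refine Fin.lastCases ?_ (fun i => ?_) i <;> simp
  · refine Fin.cases ?_ (fun i => ?_) i <;> simp

end PencilMatrix

/-! ### The quotient by its minors is free on 1, z_0, …, z_{c-1} -/

section NormalForm

variable {A : Type*} [CommRing A] {c : ℕ}

/-- The polynomials of degree at most one in the variables. -/
def affineForm (A : Type*) [CommRing A] (c : ℕ) :
    (A × (Fin c → A)) →ₗ[A] MvPolynomial (Fin c) A where
  toFun q := C q.1 + ∑ i, C (q.2 i) * X i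
  map_add' p q := by simp [add_mul, Finset.sum_add_distrib]; ring
  map_smul' r q := by simp [smul_eq_C_mul, Finset.mul_sum, mul_assoc]

theorem affineForm_apply (q : A × (Fin c → A)) :
    affineForm A c q = C q.1 + ∑ i, C (q.2 i) * X i := rfl

/-- The ideal of maximal minors of the pencil matrix in the variables `z_i`. -/
abbrev pencilIdeal (a : Fin (c + 1) → A) (b : A) : Ideal (MvPolynomial (Fin c) A) :=
  maximalMinorsIdeal (pencilMatrix X (C ∘ a) (C b))

/-- It suffices to reduce the products z_i z_j to affine forms; then affine forms modulo the ideal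
are stable under multiplication by variables. -/
theorem exists_sub_affineForm_mem (a : Fin (c + 1) → A) (b : A) (f : MvPolynomial (Fin c) A) :
    ∃ q, f - affineForm A c q ∈ pencilIdeal a b := by
  set J := pencilIdeal a b with hJ
  set G : Submodule A (MvPolynomial (Fin c) A) :=
    LinearMap.range (affineForm A c) ⊔ J.restrictScalars A with hG
  suffices h : f ∈ G by
    obtain ⟨_, ⟨q, rfl⟩, g, hg, rfl⟩ := Submodule.mem_sup.1 h
    exact ⟨q, by simpa using hg⟩
  have hJG : ∀ g ∈ J, g ∈ G := fun g hg => Submodule.mem_sup_right hg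
  have hCG : ∀ r : A, C r ∈ G := fun r =>
    Submodule.mem_sup_left ⟨(r, 0), by simp [affineForm_apply]⟩
  have hXG : ∀ i, X i ∈ G := fun i => by
    refine Submodule.mem_sup_left ⟨(0, Pi.single i 1), ?_⟩
    rw [affineForm_apply, Finset.sum_eq_single i] <;> simp +contextual
  have hCmul : ∀ (r : A) g, g ∈ G → C r * g ∈ G := fun r g hg => by
    rw [← smul_eq_C_mul]; exact G.smul_mem r hg
  have hP : ∀ g ∈ G, (∀ j, X j * g ∈ G) → ∀ i, pencilMatrix X (C ∘ a) (C b) i 0 * g ∈ G := by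
    intro g hg hXg i
    refine Fin.lastCases ?_ (fun i => ?_) i
    · rw [pencilMatrix_last_zero]
      exact hCmul _ _ hg
    · rw [pencilMatrix_castSucc_zero, add_mul]
      exact G.add_mem (hXg i) (hCmul _ _ hg)
  -- The minor of rows i and j+1 gives z_i z_j ≡ z_{i-1} (z_{j+1} + a_{j+1}) - a_i z_j, with z_c =
  -- 0. This lowers the first index, down to z_{-1} = b.
  have hstep : ∀ i : Fin c, pencilMatrix X (C ∘ a) (C b) i.castSucc 1 ∈ G →
      (∀ j, X j * pencilMatrix X (C ∘ a) (C b) i.castSucc 1 ∈ G) → ∀ j, X i * X j ∈ G := by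
    intro i hg hXg j
    have h1 := hJG _ (minor_mem_maximalMinorsIdeal (pencilMatrix X (C ∘ a) (C b))
      i.castSucc j.succ)
    have h2 := hP _ hg hXg j.succ
    have h3 := hCmul (a i.castSucc) _ (hXG j)
    have h4 := G.sub_mem (G.add_mem h1 h2) h3
    rw [pencilMatrix_castSucc_zero, pencilMatrix_succ_one, Function.comp_apply] at h4
    have e : (X i + C (a i.castSucc)) * X j -
        pencilMatrix X (C ∘ a) (C b) i.castSucc 1 * pencilMatrix X (C ∘ a) (C b) j.succ 0 +
        pencilMatrix X (C ∘ a) (C b) j.succ 0 * pencilMatrix X (C ∘ a) (C b) i.castSucc 1 -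
        C (a i.castSucc) * X j = X i * X j := by ring
    rwa [e] at h4
  have hXX : ∀ (n : ℕ) (hn : n < c) (j : Fin c), X ⟨n, hn⟩ * X j ∈ G := by
    intro n
    induction n with
    | zero =>
      intro hn
      have h0 : pencilMatrix X (C ∘ a) (C b) (Fin.castSucc ⟨0, hn⟩) 1 = C b :=
        pencilMatrix_zero_one _ _ _
      refine hstep _ ?_ fun j => ?_
      · rw [h0]; exact hCG b
      · rw [h0, mul_comm]; exact hCmul _ _ (hXG j)
    | succ n ih =>
      intro hn
      have h0 : pencilMatrix X (C ∘ a) (C b) (Fin.castSucc ⟨n + 1, hn⟩) 1 =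
          (X ⟨n, by omega⟩ : MvPolynomial (Fin c) A) :=
        pencilMatrix_succ_one _ _ _ ⟨n, by omega⟩
      refine hstep _ ?_ fun j => ?_
      · rw [h0]; exact hXG _
      · rw [h0, mul_comm]; exact ih (by omega) j
  induction f using MvPolynomial.induction_on with
  | C r => exact hCG r
  | add p q hp hq => exact G.add_mem hp hq
  | mul_X p j hp =>
    obtain ⟨_, ⟨q, rfl⟩, g, hg, rfl⟩ := Submodule.mem_sup.1 hp
    rw [add_mul, affineForm_apply, add_mul, Finset.sum_mul]
    refine G.add_mem (G.add_mem (hCmul _ _ (hXG j)) (G.sum_mem fun i _ => ?_))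
      (hJG _ (J.mul_mem_right _ hg))
    rw [mul_assoc]
    exact hCmul _ _ (hXX i i.2 j)

/-- The polynomials `t ^ i b - ∑ t ^ j a_{i-1-j}`, which parametrize the points where the rows of
the pencil matrix are proportional to `(t, 1)`. -/
def ratioPoly (a : ℕ → A) (b : A) : ℕ → Polynomial A
  | 0 => Polynomial.C b
  | i + 1 => Polynomial.X * ratioPoly a b i - Polynomial.C (a i)

theorem degree_ratioPoly [IsDomain A] (a : ℕ → A) {b : A} (hb : b ≠ 0) (i : ℕ) :
    (ratioPoly a b i).degree = i := by
  induction i with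
  | zero => simpa [ratioPoly] using Polynomial.degree_C hb
  | succ i ih =>
    have h : (Polynomial.X * ratioPoly a b i).degree = ((i + 1 : ℕ) : WithBot ℕ) := by
      rw [Polynomial.degree_mul, ih, Polynomial.degree_X]; push_cast; ring
    rw [ratioPoly, Polynomial.degree_sub_eq_left_of_degree_lt, h]
    rw [h]
    exact lt_of_le_of_lt Polynomial.degree_C_le (by exact_mod_cast Nat.succ_pos i)

/-- Send z_i to ζ_{i+1}. Row i becomes ζ_i · (t, 1), except that the last row is off by (ζ_{c+1},
0), so all minors land in (ζ_{c+1}). An affine form goes to a combination of 1, ζ_1, …, ζ_c, of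
degrees 0, …, c since b ≠ 0. Being a multiple of ζ_{c+1}, which has degree c+1, it vanishes together
with its coefficients. -/
theorem affineForm_mem_of_ne_zero [IsDomain A] (a : Fin (c + 1) → A) {b : A} (hb : b ≠ 0)
    (q : A × (Fin c → A)) (hq : affineForm A c q ∈ pencilIdeal a b) : q = 0 := by
  set a' : ℕ → A := fun i => if h : i < c + 1 then a ⟨i, h⟩ else 0 with ha'
  set ζ := ratioPoly a' b with hζ
  have ha : ∀ i : Fin (c + 1), a i = a' i := fun i => by simp only [ha', i.is_lt, dite_true]
  have hsucc : ∀ i : ℕ, ζ (i + 1) + Polynomial.C (a' i) = Polynomial.X * ζ i := fun i => by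
    simp [hζ, ratioPoly]
  let θ : MvPolynomial (Fin c) A →ₐ[A] Polynomial A := aeval fun i => ζ (i + 1)
  have hθC : ∀ r, θ (C r) = Polynomial.C r := fun r => by simp [θ]
  have hθX : ∀ i, θ (X i) = ζ (i + 1) := fun i => by simp [θ]
  have h1 : ∀ i, (pencilMatrix X (C ∘ a) (C b)).map θ i 1 = ζ i := by
    intro i
    refine Fin.cases ?_ (fun i => ?_) i
    · simp [hθC, hζ, ratioPoly]
    · simp [hθX]
  have h0 : ∀ i, (pencilMatrix X (C ∘ a) (C b)).map θ i 0 =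
      Polynomial.X * ζ i - if i = Fin.last c then ζ (c + 1) else 0 := by
    intro i
    refine Fin.lastCases ?_ (fun i => ?_) i
    · simp [hθC, ha, ← hsucc]
    · simp [hθC, hθX, ha, ← hsucc, Fin.castSucc_ne_last]
  have hle : pencilIdeal a b ≤ (Ideal.span {ζ (c + 1)}).comap θ := by
    rw [maximalMinorsIdeal_le_iff]
    intro i j
    rw [Ideal.mem_comap, map_sub, map_mul, map_mul, Ideal.mem_span_singleton]
    have e0 := h0
    have e1 := h1
    simp only [Matrix.map_apply] at e0 e1
    rw [e0, e0, e1, e1]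
    have : (Polynomial.X * ζ ↑i - if i = Fin.last c then ζ (c + 1) else 0) * ζ ↑j -
        ζ ↑i * (Polynomial.X * ζ ↑j - if j = Fin.last c then ζ (c + 1) else 0) =
        ζ (c + 1) * (ζ i * (if j = Fin.last c then 1 else 0) -
          ζ j * (if i = Fin.last c then 1 else 0)) := by
      split_ifs <;> ring
    rw [this]
    exact dvd_mul_right _ _
  -- The constant term of an affine form is a multiple of 1, not of ζ_0 = b, hence the change in
  -- degree zero.
  let s : Polynomial.Sequence A :=
    { elems' := fun i => if i = 0 then 1 else ζ i
      degree_eq' := fun i => by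
        by_cases h : i = 0
        · simp [h]
        · simpa [h] using degree_ratioPoly a' hb i }
  let w : Fin (c + 1) → A := Fin.cons q.1 q.2
  have hs0 : s 0 = 1 := rfl
  have hss : ∀ i, s (i + 1) = ζ (i + 1) := fun i => rfl
  have hw : θ (affineForm A c q) = ∑ i : Fin (c + 1), w i • s i := by
    rw [Fin.sum_univ_succ, affineForm_apply]
    simp [w, hθC, hθX, hs0, hss, Polynomial.smul_eq_C_mul]
  have hdvd := Ideal.mem_span_singleton.1 (hle hq)
  have hzero : θ (affineForm A c q) = 0 := by
    refine Polynomial.eq_zero_of_dvd_of_degree_lt hdvd ?_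
    rw [degree_ratioPoly a' hb, hw]
    refine lt_of_le_of_lt (Polynomial.degree_sum_le _ _) ?_
    rw [Finset.sup_lt_iff (WithBot.bot_lt_coe _)]
    intro i _
    refine lt_of_le_of_lt (Polynomial.degree_smul_le _ _) ?_
    rw [s.degree_eq]
    exact_mod_cast i.2
  have hli := (s.linearIndependent).comp (fun i : Fin (c + 1) => (i : ℕ)) Fin.val_injective
  rw [hw] at hzero
  have hw0 := Fintype.linearIndependent_iff.1 hli w hzero
  refine Prod.ext (hw0 0) (funext fun i => ?_)
  simpa [w] using hw0 i.succ

/-- To allow b = 0, deform b to b + ε over A[ε], where the nonzero case applies. An affine form q in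
the original ideal equals ε h modulo the deformed one; replacing h by an affine form p gives q = ε
p, and comparing coefficients of ε⁰ gives q = 0. -/
theorem affineForm_mem_pencilIdeal [IsDomain A] (a : Fin (c + 1) → A) (b : A)
    (q : A × (Fin c → A)) (hq : affineForm A c q ∈ pencilIdeal a b) : q = 0 := by
  let ι : MvPolynomial (Fin c) A →+* MvPolynomial (Fin c) (Polynomial A) := map Polynomial.C
  set a' : Fin (c + 1) → Polynomial A := Polynomial.C ∘ a
  set b' : Polynomial A := Polynomial.C b + Polynomial.X
  have hb' : b' ≠ 0 := fun h => by
    have := congrArg (fun p => Polynomial.coeff p 1) h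
    simp [b'] at this
  let xI : Ideal (MvPolynomial (Fin c) (Polynomial A)) := Ideal.span {C Polynomial.X}
  have hle : pencilIdeal a b ≤ (pencilIdeal a' b' ⊔ xI).comap ι := by
    rw [maximalMinorsIdeal_le_iff]
    intro i j
    rw [Ideal.mem_comap, ← Ideal.Quotient.eq_zero_iff_mem]
    have hx : Ideal.Quotient.mk (pencilIdeal a' b' ⊔ xI) (C Polynomial.X) = 0 :=
      Ideal.Quotient.eq_zero_iff_mem.2 (Ideal.mem_sup_right (Ideal.mem_span_singleton_self _))
    have hm := minor_mem_maximalMinorsIdeal (pencilMatrix X (C ∘ a') (C b')) i j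
    have hm' := Ideal.Quotient.eq_zero_iff_mem.2 (Ideal.mem_sup_left (T := xI) hm)
    have key : (pencilMatrix X (C ∘ a) (C b)).map
        ((Ideal.Quotient.mk (pencilIdeal a' b' ⊔ xI)).comp ι) =
        (pencilMatrix X (C ∘ a') (C b')).map (Ideal.Quotient.mk (pencilIdeal a' b' ⊔ xI)) := by
      rw [pencilMatrix_map, pencilMatrix_map]
      congr 1
      · funext i; simp [ι]
      · funext i; simp [ι, a']
      · simp [ι, b', hx]
    have k0 := fun i j => congrFun (congrFun key i) j
    simp only [Matrix.map_apply, RingHom.comp_apply] at k0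
    simp only [map_sub, map_mul] at hm' ⊢
    simpa only [k0] using hm'
  let q' : Polynomial A × (Fin c → Polynomial A) := (Polynomial.C q.1, fun i => Polynomial.C (q.2 i))
  have hιq : ι (affineForm A c q) = affineForm _ c q' := by
    simp [affineForm_apply, ι, q']
  have hmem := hle hq
  rw [Ideal.mem_comap, hιq] at hmem
  obtain ⟨g, hg, _, hh, hgh⟩ := Submodule.mem_sup.1 hmem
  obtain ⟨h, rfl⟩ := Ideal.mem_span_singleton.1 hh
  obtain ⟨p, hp⟩ := exists_sub_affineForm_mem a' b' h
  have h0 : affineForm _ c (q' - (Polynomial.X : Polynomial A) • p) ∈ pencilIdeal a' b' := by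
    rw [map_sub, map_smul, smul_eq_C_mul, ← hgh]
    have := Ideal.add_mem _ hg (Ideal.mul_mem_left _ (C Polynomial.X) hp)
    convert this using 1
    ring
  have h1 := affineForm_mem_of_ne_zero a' hb' _ h0
  have e1 := congrArg (fun x => Polynomial.coeff x.1 0) h1
  have e2 := fun i => congrArg (fun x => Polynomial.coeff (x.2 i) 0) h1
  refine Prod.ext ?_ (funext fun i => ?_)
  · simpa [q'] using e1
  · simpa [q'] using e2 i

end NormalForm

/-! ### Krull dimension of cones and linear Noether normalization -/

section LinearNormalization

variable {K : Type*} [Field K] {n : ℕ}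

/-- The linear form with given coefficients. -/
def linearForm (K : Type*) [Field K] (n : ℕ) : (Fin n → K) →ₗ[K] MvPolynomial (Fin n) K where
  toFun v := ∑ j, C (v j) * X j
  map_add' v w := by simp [add_mul, Finset.sum_add_distrib]
  map_smul' r v := by simp [smul_eq_C_mul, Finset.mul_sum, mul_assoc]

theorem linearForm_apply (v : Fin n → K) : linearForm K n v = ∑ j, C (v j) * X j := rfl

theorem linearForm_single (j : Fin n) : linearForm K n (Pi.single j 1) = X j := by
  rw [linearForm_apply, Finset.sum_eq_single j] <;> simp +contextual

theorem eval_linearForm (v x : Fin n → K) : eval x (linearForm K n v) = v ⬝ᵥ x := by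
  simp [linearForm_apply, dotProduct]

theorem isHomogeneous_linearForm (v : Fin n → K) : (linearForm K n v).IsHomogeneous 1 :=
  IsHomogeneous.sum _ _ _ fun j _ => by
    simpa using (isHomogeneous_C _ (v j)).mul (isHomogeneous_X K j)

/-- A chain of primes over `I'` extends downwards: its smallest member contains a minimal prime of
`I`, strictly because `f` lies only in the larger one. -/
theorem ringKrullDim_quotient_succ_le {R : Type*} [CommRing R] {I I' : Ideal R} (hle : I ≤ I')
    {f : R} (hf : f ∈ I') (hmin : ∀ p ∈ I.minimalPrimes, f ∉ p) :
    ringKrullDim (R ⧸ I') + 1 ≤ ringKrullDim (R ⧸ I) := by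
  by_cases htop : I' = ⊤
  · rw [htop, ringKrullDim_eq_bot_of_subsingleton]
    simp
  have : Nonempty (PrimeSpectrum.zeroLocus (R := R) I') := by
    rwa [Set.nonempty_coe_sort, Set.nonempty_iff_ne_empty, ne_eq,
      PrimeSpectrum.zeroLocus_empty_iff_eq_top]
  have hsub : PrimeSpectrum.zeroLocus (I' : Set R) ⊆ PrimeSpectrum.zeroLocus (I : Set R) :=
    PrimeSpectrum.zeroLocus_anti_mono hle
  have : Nonempty (PrimeSpectrum.zeroLocus (R := R) I) := this.map (Set.inclusion hsub)
  rw [ringKrullDim_quotient, Order.krullDim_eq_iSup_length, ringKrullDim_quotient,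
    Order.krullDim_eq_iSup_length, ← WithBot.coe_one, ← WithBot.coe_add,
    ENat.iSup_add, WithBot.coe_le_coe, iSup_le_iff]
  intro l
  obtain ⟨p, hp, hpl⟩ := Ideal.exists_minimalPrimes_le (J := l.head.1.asIdeal)
    (hle.trans l.head.2)
  let p' : PrimeSpectrum.zeroLocus (I : Set R) := ⟨⟨p, hp.1.1⟩, hp.1.2⟩
  have hlt : p' < Set.inclusion hsub l.head := by
    refine lt_of_le_of_ne hpl fun h => hmin p hp ?_
    have h' : p = l.head.1.asIdeal := congrArg (fun q => q.1.asIdeal) h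
    rw [h']
    exact l.head.2 hf
  have hmono : StrictMono (Set.inclusion hsub) := fun _ _ h => h
  have hlt' : p' < (l.map (Set.inclusion hsub) hmono).head := hlt
  have hlen : (l.length : ℕ∞) + 1 =
      ((RelSeries.cons (l.map (Set.inclusion hsub) hmono) p' hlt').length : ℕ∞) := by
    rw [RelSeries.cons_length]
    simp
  rw [hlen]
  exact le_iSup (fun q : LTSeries (PrimeSpectrum.zeroLocus (I : Set R)) => (q.length : ℕ∞)) _

/-- The ideal of the origin. -/
abbrev originIdeal (K : Type*) [Field K] (n : ℕ) : Ideal (MvPolynomial (Fin n) K) :=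
  RingHom.ker (eval (0 : Fin n → K))

/-- The prime is the ideal of the line through `x`, the kernel of restriction to t ↦ t x. Over an
infinite field, vanishing at all t means restricting to the zero polynomial. -/
theorem exists_isPrime_lt_originIdeal [Infinite K] {I : Ideal (MvPolynomial (Fin n) K)}
    {x : Fin n → K} (hx : x ≠ 0) (hI : ∀ t : K, ∀ f ∈ I, eval (t • x) f = 0) :
    ∃ p : Ideal (MvPolynomial (Fin n) K), p.IsPrime ∧ I ≤ p ∧ p < originIdeal K n := by
  let φ : MvPolynomial (Fin n) K →+* Polynomial K :=
    eval₂Hom Polynomial.C fun j => Polynomial.C (x j) * Polynomial.X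
  have hφ : ∀ t f, Polynomial.eval t (φ f) = eval (t • x) f := by
    intro t f
    change ((Polynomial.evalRingHom t).comp φ) f = _
    congr 1
    refine MvPolynomial.ringHom_ext (fun r => by simp [φ]) fun j => ?_
    simp only [φ, RingHom.comp_apply, eval₂Hom_X', Polynomial.coe_evalRingHom, eval_X,
      Polynomial.eval_mul, Polynomial.eval_C, Polynomial.eval_X, Pi.smul_apply, smul_eq_mul]
    exact mul_comm _ _
  refine ⟨RingHom.ker φ, RingHom.ker_isPrime φ, fun f hf => ?_, lt_of_le_of_ne ?_ ?_⟩
  · rw [RingHom.mem_ker]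
    refine Polynomial.funext fun t => ?_
    rw [hφ, hI t f hf, Polynomial.eval_zero]
  · intro f hf
    rw [RingHom.mem_ker] at hf ⊢
    have := hφ 0 f
    rwa [hf, zero_smul, Polynomial.eval_zero, eq_comm] at this
  · intro h
    refine hx (funext fun j => ?_)
    have hj : (X j : MvPolynomial (Fin n) K) ∈ RingHom.ker φ := by
      rw [h, RingHom.mem_ker]; simp
    rw [RingHom.mem_ker] at hj
    have := hφ 1 (X j)
    rw [hj] at this
    simpa using this.symm

theorem eq_originIdeal_of_X_mem {p : Ideal (MvPolynomial (Fin n) K)} (hp : p.IsPrime)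
    (hX : ∀ j, X j ∈ p) : p = originIdeal K n := by
  have key : ∀ f : MvPolynomial (Fin n) K, f - C (eval 0 f) ∈ p := by
    intro f
    induction f using MvPolynomial.induction_on with
    | C r => simp
    | add f g hf hg =>
      have := p.add_mem hf hg
      rw [map_add, map_add]
      convert this using 1
      ring
    | mul_X f j _ => simpa using p.mul_mem_left f (hX j)
  have : originIdeal K n ≤ p := fun f hf => by
    have := key f
    rw [RingHom.mem_ker] at hf
    rwa [hf, map_zero, sub_zero] at this
  have hmax : (originIdeal K n).IsMaximal :=
    RingHom.ker_isMaximal_of_surjective _ fun r => ⟨C r, by simp⟩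
  exact (hmax.eq_of_le hp.ne_top this).symm

/-- The linear forms in a minimal prime make up a proper subspace, since a prime containing all
variables is the ideal of the origin. Finitely many proper subspaces do not cover a space over an
infinite field. -/
theorem exists_linearForm_notMem_minimalPrimes [Infinite K] {I : Ideal (MvPolynomial (Fin n) K)}
    (hI : originIdeal K n ∉ I.minimalPrimes) :
    ∃ v : Fin n → K, ∀ p ∈ I.minimalPrimes, linearForm K n v ∉ p := by
  classical
  have hfin := Ideal.finite_minimalPrimes_of_isNoetherianRing _ I
  let W : Ideal (MvPolynomial (Fin n) K) → Submodule K (Fin n → K) := fun p =>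
    (p.restrictScalars K).comap (linearForm K n)
  have hne := Subspace.biUnion_ne_univ_of_top_notMem (s := hfin.toFinset.image W) (by
    intro h
    obtain ⟨p, hp, hW⟩ := Finset.mem_image.1 h
    rw [Set.Finite.mem_toFinset] at hp
    refine hI (eq_originIdeal_of_X_mem hp.1.1 (fun j => ?_) ▸ hp)
    have : Pi.single j 1 ∈ W p := hW ▸ Submodule.mem_top
    simpa [W, linearForm_single] using this)
  obtain ⟨v, hv⟩ := (Set.ne_univ_iff_exists_notMem _).1 hne
  refine ⟨v, fun p hp h => hv ?_⟩
  simp only [Set.mem_iUnion]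
  exact ⟨W p, Finset.mem_image_of_mem W (hfin.mem_toFinset.2 hp), h⟩

/-- Noether normalization by linear forms: a cone of dimension at most `d` meets some subspace
defined by `d` linear equations in the origin only. -/
theorem exists_linear_parameters [Infinite K] (d : ℕ) (I : Ideal (MvPolynomial (Fin n) K))
    (hcone : ∀ x, (∀ f ∈ I, eval x f = 0) → ∀ t : K, ∀ f ∈ I, eval (t • x) f = 0)
    (hdim : ringKrullDim (MvPolynomial (Fin n) K ⧸ I) ≤ d) :
    ∃ y : Fin d → Fin n → K, ∀ x, (∀ f ∈ I, eval x f = 0) → (∀ l, y l ⬝ᵥ x = 0) → x = 0 := by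
  induction d generalizing I with
  | zero =>
    refine ⟨0, fun x hx _ => ?_⟩
    -- A nonzero point would give a chain of two primes over `I`: the ideal of its line and that of
    -- the origin.
    by_contra hne
    obtain ⟨p, hp, hIp, hlt⟩ := exists_isPrime_lt_originIdeal hne (hcone x hx)
    rw [Nat.cast_zero, ringKrullDim_quotient, Order.krullDim_nonpos_iff_forall_isMax] at hdim
    have hprime : (originIdeal K n).IsPrime := RingHom.ker_isPrime _
    let p' : PrimeSpectrum.zeroLocus (I : Set (MvPolynomial (Fin n) K)) := ⟨⟨p, hp⟩, hIp⟩
    let m' : PrimeSpectrum.zeroLocus (I : Set (MvPolynomial (Fin n) K)) :=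
      ⟨⟨originIdeal K n, hprime⟩, hIp.trans hlt.le⟩
    exact (hdim p').not_lt (show p' < m' from hlt)
  | succ d ih =>
    by_cases hex : ∃ x, (∀ f ∈ I, eval x f = 0) ∧ x ≠ 0
    · obtain ⟨x, hx, hne⟩ := hex
      obtain ⟨p, hp, hIp, hlt⟩ := exists_isPrime_lt_originIdeal hne (hcone x hx)
      obtain ⟨v, hv⟩ := exists_linearForm_notMem_minimalPrimes (I := I)
        fun h => hlt.not_ge (h.2 ⟨hp, hIp⟩ hlt.le)
      have hmem : ∀ x, (∀ f ∈ I ⊔ Ideal.span {linearForm K n v}, eval x f = 0) ↔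
          (∀ f ∈ I, eval x f = 0) ∧ v ⬝ᵥ x = 0 := by
        intro x
        have h1 : (∀ f ∈ I ⊔ Ideal.span {linearForm K n v}, eval x f = 0) ↔
          I ⊔ Ideal.span {linearForm K n v} ≤ RingHom.ker (eval x) := Iff.rfl
        rw [h1, sup_le_iff, Ideal.span_singleton_le_iff_mem, RingHom.mem_ker, eval_linearForm]
        exact Iff.rfl
      obtain ⟨y, hy⟩ := ih (I ⊔ Ideal.span {linearForm K n v})
        (fun x hx t => by
          rw [hmem] at hx ⊢
          exact ⟨hcone x hx.1 t, by rw [dotProduct_smul, hx.2, smul_zero]⟩)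
        (by
          have := (ringKrullDim_quotient_succ_le le_sup_left
            (Ideal.mem_sup_right (Ideal.mem_span_singleton_self _)) hv).trans hdim
          rw [Nat.cast_succ] at this
          exact ENat.WithBot.add_le_add_one_right_iff.1 this)
      refine ⟨Fin.cons v y, fun x hx hl => hy x ((hmem x).2 ⟨hx, hl 0⟩) fun l => hl l.succ⟩
    -- The cone is at most the origin, so any equations will do.
    · push Not at hex
      exact ⟨0, fun x hx _ => hex x hx⟩

end LinearNormalization

/-! ### Kronecker normal form of an injective pencil -/

section Chain

variable {K : Type*} [Field K]

/-- The orthogonal complement for the dot product. -/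
def dotPerp {n : ℕ} (T : Submodule K (Fin n → K)) : Submodule K (Fin n → K) :=
  (T.map (dotProductEquiv K (Fin n)).toLinearMap).dualCoannihilator

theorem mem_dotPerp {n : ℕ} {T : Submodule K (Fin n → K)} {z : Fin n → K} :
    z ∈ dotPerp T ↔ ∀ t ∈ T, t ⬝ᵥ z = 0 := by
  rw [dotPerp, Submodule.mem_dualCoannihilator]
  refine ⟨fun h t ht => h _ ⟨t, ht, rfl⟩, ?_⟩
  rintro h _ ⟨t, ht, rfl⟩
  exact h t ht

theorem finrank_add_finrank_dotPerp {n : ℕ} (T : Submodule K (Fin n → K)) :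
    Module.finrank K T + Module.finrank K (dotPerp T) = n := by
  have := Subspace.finrank_add_finrank_dualCoannihilator_eq
    (T.map (dotProductEquiv K (Fin n)).toLinearMap)
  rwa [LinearEquiv.finrank_map_eq, Module.finrank_fin_fun] at this

variable {c : ℕ}

/-- There are (c+1)² unknowns and only c² + 2c linear conditions. -/
theorem exists_chain_ne_zero (U V : Matrix (Fin (c + 1)) (Fin c) K) :
    ∃ L : Matrix (Fin (c + 1)) (Fin (c + 1)) K, L ≠ 0 ∧ (L * V) 0 = 0 ∧
      (L * U) (Fin.last c) = 0 ∧ ∀ i : Fin c, (L * U) i.castSucc = (L * V) i.succ := by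
  let Ψ : Matrix (Fin (c + 1)) (Fin (c + 1)) K →ₗ[K]
      (Fin c → Fin c → K) × (Fin c → K) × (Fin c → K) :=
    { toFun := fun L => (fun i => (L * U) i.castSucc - (L * V) i.succ, (L * V) 0,
        (L * U) (Fin.last c))
      map_add' := fun L M => by
        refine Prod.ext ?_ (Prod.ext ?_ ?_) <;> ext <;> simp [Matrix.add_mul]; ring
      map_smul' := fun r L => by
        refine Prod.ext ?_ (Prod.ext ?_ ?_) <;> ext <;> simp [mul_sub] }
  have hker : LinearMap.ker Ψ ≠ ⊥ := by
    refine LinearMap.ker_ne_bot_of_finrank_lt ?_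
    simp only [Module.finrank_prod, Module.finrank_pi_fintype, Module.finrank_self,
      Module.finrank_matrix, Finset.sum_const, Finset.card_univ, Fintype.card_fin, smul_eq_mul]
    nlinarith
  obtain ⟨L, hL, hne⟩ := Submodule.exists_mem_ne_zero_of_ne_bot hker
  rw [LinearMap.mem_ker] at hL
  have h1 := congrArg Prod.fst hL
  have h2 := congrArg (fun x => x.2.1) hL
  have h3 := congrArg (fun x => x.2.2) hL
  exact ⟨L, hne, h2, h3, fun i => sub_eq_zero.1 (congrFun h1 i)⟩

theorem mul_row (L : Matrix (Fin (c + 1)) (Fin (c + 1)) K) (V : Matrix (Fin (c + 1)) (Fin c) K)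
    (i : Fin (c + 1)) : (L * V) i = Matrix.vecMul (L i) V := by
  rw [Matrix.mul_apply_eq_vecMul]

/-- A pencil of `(c+1) × c` matrices which is injective at every point of the projective line
is in Kronecker normal form in suitable coordinates. -/
theorem exists_chain [IsAlgClosed K] (U V : Matrix (Fin (c + 1)) (Fin c) K)
    (hnd : ∀ z : Fin c → K,
      (∀ i j, (U.mulVec z) i * (V.mulVec z) j = (U.mulVec z) j * (V.mulVec z) i) → z = 0) :
    ∃ L : Matrix (Fin (c + 1)) (Fin (c + 1)) K, IsUnit L ∧ (L * V) 0 = 0 ∧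
      (L * U) (Fin.last c) = 0 ∧ (∀ i : Fin c, (L * U) i.castSucc = (L * V) i.succ) ∧
      LinearIndependent K fun i : Fin c => (L * V) i.succ := by
  obtain ⟨L, hne, h0, hlast, hstep⟩ := exists_chain_ne_zero U V
  set W : Submodule K (Fin (c + 1) → K) := Submodule.span K (Set.range L.row) with hW
  set S := W.map V.vecMulLinear with hS
  have hrow : ∀ i, L i ∈ W := fun i => Submodule.subset_span ⟨i, rfl⟩
  have hSV : ∀ t ∈ W, Matrix.vecMul t V ∈ S := fun t ht => Submodule.mem_map_of_mem ht
  have hSspan : S = Submodule.span K (Set.range fun i : Fin c => (L * V) i.succ) := by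
    refine le_antisymm ?_ (Submodule.span_le.2 ?_)
    · rw [hS, hW, Submodule.map_span, Submodule.span_le]
      rintro _ ⟨_, ⟨i, rfl⟩, rfl⟩
      change Matrix.vecMul (L i) V ∈ _
      rw [← mul_row]
      refine Fin.cases ?_ (fun i => ?_) i
      · rw [h0]; exact Submodule.zero_mem _
      · exact Submodule.subset_span ⟨i, rfl⟩
    · rintro _ ⟨i, rfl⟩
      simp only
      rw [mul_row]
      exact hSV _ (hrow _)
  have hSU : ∀ t ∈ W, Matrix.vecMul t U ∈ S := by
    have : W ≤ S.comap U.vecMulLinear := by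
      rw [hW, Submodule.span_le]
      rintro _ ⟨i, rfl⟩
      change Matrix.vecMul (L i) U ∈ S
      rw [← mul_row]
      refine Fin.lastCases ?_ (fun i => ?_) i
      · rw [hlast]; exact Submodule.zero_mem _
      · rw [hstep, mul_row]; exact hSV _ (hrow _)
    exact this
  -- If V were injective on the row span `W`, then L_0 V = 0 would kill row 0, and L_{i+1} V = L_i U
  -- would kill the other rows in turn.
  have hlt : Module.finrank K S < Module.finrank K W := by
    have hker : LinearMap.ker (V.vecMulLinear.domRestrict W) ≠ ⊥ := by
      intro hbot
      have hz : ∀ t ∈ W, Matrix.vecMul t V = 0 → t = 0 := fun t ht h0 => by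
        have : (⟨t, ht⟩ : W) ∈ LinearMap.ker (V.vecMulLinear.domRestrict W) := h0
        rw [hbot, Submodule.mem_bot] at this
        exact congrArg Subtype.val this
      refine hne (funext fun i => ?_)
      induction i using Fin.induction with
      | zero => exact hz _ (hrow _) (by rw [← mul_row]; exact h0)
      | succ i ih =>
        refine hz _ (hrow _) ?_
        rw [← mul_row, ← hstep, mul_row, ih]
        exact Matrix.zero_vecMul _
    have h1 := (V.vecMulLinear.domRestrict W).finrank_range_add_finrank_ker
    rw [LinearMap.range_domRestrict] at h1
    have h2 := Submodule.one_le_finrank_iff.2 hker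
    change Module.finrank K (W.map V.vecMulLinear) < _
    omega
  have hV : ∀ z, V.mulVec z = 0 → z = 0 := fun z hz => hnd z fun i j => by simp [hz]
  have hUV : ∀ z (μ : K), U.mulVec z = μ • V.mulVec z → z = 0 := fun z μ hz => hnd z fun i j => by
    simp [hz]; ring
  -- Both U and V map S^⊥ into W^⊥. As V is injective and dim S^⊥ ≥ dim W^⊥, it is an isomorphism
  -- there. If S^⊥ ≠ 0, an eigenvector of V⁻¹U satisfies U z = μ V z, against `hUV`.
  have hStop : S = ⊤ := by
    have d1 := finrank_add_finrank_dotPerp S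
    have d2 := finrank_add_finrank_dotPerp W
    let g : dotPerp S →ₗ[K] dotPerp W := V.mulVecLin.restrict fun z hz => by
      rw [mem_dotPerp] at hz ⊢
      intro t ht
      rw [Matrix.mulVecLin_apply, Matrix.dotProduct_mulVec]
      exact hz _ (hSV t ht)
    let h : dotPerp S →ₗ[K] dotPerp W := U.mulVecLin.restrict fun z hz => by
      rw [mem_dotPerp] at hz ⊢
      intro t ht
      rw [Matrix.mulVecLin_apply, Matrix.dotProduct_mulVec]
      exact hz _ (hSU t ht)
    have hg : Function.Injective g := by
      rw [← LinearMap.ker_eq_bot, LinearMap.ker_eq_bot']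
      intro z hz
      exact Subtype.ext (hV z (congrArg Subtype.val hz))
    have d3 := LinearMap.finrank_le_finrank_of_injective hg
    have d4 : Module.finrank K (dotPerp S) = Module.finrank K (dotPerp W) := by omega
    let e := LinearEquiv.ofInjectiveOfFinrankEq g hg d4
    by_contra hStop
    have d5 := Submodule.finrank_lt hStop
    rw [Module.finrank_fin_fun] at d5
    have : Nontrivial (dotPerp S) := Module.nontrivial_of_finrank_pos (R := K) (by omega)
    obtain ⟨μ, hμ⟩ := Module.End.exists_eigenvalue (e.symm.toLinearMap ∘ₗ h)
    obtain ⟨z, hz⟩ := hμ.exists_hasEigenvector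
    have h1 : e.symm (h z) = μ • z := hz.apply_eq_smul
    have h2 : h z = μ • g z := by
      rw [LinearEquiv.symm_apply_eq] at h1
      rw [h1, map_smul]
      rfl
    exact hz.2 (Subtype.ext (hUV z μ (congrArg Subtype.val h2)))
  have hSc : Module.finrank K S = c := by rw [hStop, finrank_top, Module.finrank_fin_fun]
  have hWtop : W = ⊤ := Submodule.eq_top_of_finrank_eq (le_antisymm (Submodule.finrank_le _)
    (by rw [Module.finrank_fin_fun]; omega))
  refine ⟨L, ?_, h0, hlast, hstep, ?_⟩
  · rw [← Matrix.linearIndependent_rows_iff_isUnit]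
    exact linearIndependent_of_top_le_span_of_card_eq_finrank hWtop.ge (by simp)
  · exact linearIndependent_of_top_le_span_of_card_eq_finrank (hSspan ▸ hStop.ge) (by simp)

end Chain

/-! ### Graded pieces of polynomial rings -/

section HomogeneousComponents

variable {K : Type*} [Field K] {σ τ : Type*}

theorem homogeneousComponent_mul_of_isHomogeneous_one (p : MvPolynomial σ K)
    {l : MvPolynomial σ K} (hl : l.IsHomogeneous 1) (e : ℕ) :
    homogeneousComponent (e + 1) (p * l) = homogeneousComponent e p * l := by
  induction p using MvPolynomial.induction_on' with
  | monomial d r =>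
    have h1 := isHomogeneous_monomial r (rfl : d.degree = d.degree)
    rw [homogeneousComponent_of_mem (h1.mul hl), homogeneousComponent_of_mem h1]
    simp only [add_left_inj, ite_mul, zero_mul]
  | add p q hp hq => rw [add_mul, map_add, hp, hq, map_add, add_mul]

theorem homogeneousComponent_aeval {l : τ → MvPolynomial σ K} (hl : ∀ i, (l i).IsHomogeneous 1)
    (p : MvPolynomial τ K) (e : ℕ) :
    homogeneousComponent e (aeval l p) = aeval l (homogeneousComponent e p) := by
  induction p using MvPolynomial.induction_on' with
  | monomial d r =>
    have h1 := isHomogeneous_monomial r (rfl : d.degree = d.degree)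
    have h2 := h1.aeval l hl
    rw [one_mul] at h2
    rw [homogeneousComponent_of_mem h2, homogeneousComponent_of_mem h1]
    split_ifs <;> simp
  | add p q hp hq => rw [map_add, map_add, hp, hq, map_add, map_add]

theorem finrank_homogeneousSubmodule (r e : ℕ) :
    Module.finrank K (homogeneousSubmodule (Fin (r + 1)) K e) = (e + r).choose r := by
  have h0 : homogeneousSubmodule (Fin (r + 1)) K e =
      restrictSupport K {d : Fin (r + 1) →₀ ℕ | d.degree = e} :=
    homogeneousSubmodule_eq_finsupp_supported _ _ e
  rw [h0, Module.finrank_eq_nat_card_basis (basisRestrictSupport K _)]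
  have h1 : {d : Fin (r + 1) →₀ ℕ | d.degree = e} =
      (Finset.finsuppAntidiag (Finset.univ : Finset (Fin (r + 1))) e : Set _) := by
    ext d
    simp [Finset.mem_finsuppAntidiag, Finsupp.degree_eq_sum]
  rw [h1, Nat.card_eq_card_toFinset, Finset.toFinset_coe,
    Finset.card_finsuppAntidiag_nat_eq_choose, Finset.card_univ, Fintype.card_fin]
  rw [show r + 1 + e - 1 = e + r by omega]
  exact Nat.choose_symm_add.symm ▸ rfl

end HomogeneousComponents

/-! ### Hilbert function of the normal form -/

section PencilHilbertFunction

variable {K : Type*} [Field K] {n m c : ℕ}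

/-- The polynomials of degree at most one in the `z_i` with coefficients in `K[y_1, …, y_m]`. -/
def affineCombination (y : Fin m → Fin n → K) (z : Fin c → Fin n → K) :
    (MvPolynomial (Fin m) K × (Fin c → MvPolynomial (Fin m) K)) →ₗ[K] MvPolynomial (Fin n) K where
  toFun q := aeval (linearForm K n ∘ y) q.1 +
    ∑ i, aeval (linearForm K n ∘ y) (q.2 i) * linearForm K n (z i)
  map_add' p q := by simp [add_mul, Finset.sum_add_distrib]; ring
  map_smul' r q := by simp [Finset.smul_sum]

theorem affineCombination_apply (y : Fin m → Fin n → K) (z : Fin c → Fin n → K)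
    (q : MvPolynomial (Fin m) K × (Fin c → MvPolynomial (Fin m) K)) :
    affineCombination y z q = aeval (linearForm K n ∘ y) q.1 +
      ∑ i, aeval (linearForm K n ∘ y) (q.2 i) * linearForm K n (z i) := rfl

theorem homogeneousComponent_affineCombination (y : Fin m → Fin n → K) (z : Fin c → Fin n → K)
    (q : MvPolynomial (Fin m) K × (Fin c → MvPolynomial (Fin m) K)) (e : ℕ) :
    homogeneousComponent (e + 1) (affineCombination y z q) =
      affineCombination y z
        (homogeneousComponent (e + 1) q.1, fun i => homogeneousComponent e (q.2 i)) := by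
  have hy : ∀ l, ((linearForm K n ∘ y) l).IsHomogeneous 1 := fun l => isHomogeneous_linearForm _
  simp only [affineCombination_apply, map_add, map_sum, homogeneousComponent_aeval hy,
    homogeneousComponent_mul_of_isHomogeneous_one _ (isHomogeneous_linearForm _)]

/-- The ideal of minors of a pencil matrix of linear forms in the coordinates `y, z`. -/
abbrev linearPencilIdeal (y : Fin m → Fin n → K) (z : Fin c → Fin n → K)
    (α : Fin (c + 1) → Fin m → K) (β : Fin m → K) : Ideal (MvPolynomial (Fin n) K) :=
  maximalMinorsIdeal (pencilMatrix (linearForm K n ∘ z)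
    (fun i => linearForm K n (∑ l, α i l • y l)) (linearForm K n (∑ l, β l • y l)))

variable {y : Fin m → Fin n → K} {z : Fin c → Fin n → K}

/-- A linear change of coordinates identifies K[x] with K[y][z]; it transports the normal form over
the domain A = K[y]. -/
theorem exists_coordinate_algHoms (hyz : LinearIndependent K (Sum.elim y z)) (hn : m + c = n) :
    ∃ (g : MvPolynomial (Fin c) (MvPolynomial (Fin m) K) →ₐ[K] MvPolynomial (Fin n) K)
      (g' : MvPolynomial (Fin n) K →ₐ[K] MvPolynomial (Fin c) (MvPolynomial (Fin m) K)),
      (∀ t, g (C t) = aeval (linearForm K n ∘ y) t) ∧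
      (∀ i, g (X i) = linearForm K n (z i)) ∧ (∀ f, g (g' f) = f) ∧
      (∀ t, g' (aeval (linearForm K n ∘ y) t) = C t) ∧
      ∀ i, g' (linearForm K n (z i)) = X i := by
  let T := MvPolynomial (Fin m) K
  let M := MvPolynomial (Fin c) T
  let B : Module.Basis (Fin m ⊕ Fin c) K (Fin n → K) :=
    basisOfLinearIndependentOfCardEqFinrank' _ hyz (by simp [hn])
  have hB : ∀ s, B s = Sum.elim y z s := fun s => by simp [B]
  let ℓ : (Fin n → K) →ₗ[K] M := B.constr K (Sum.elim (fun l => C (X l)) X)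
  have hℓy : ∀ l, ℓ (y l) = C (X l) := fun l => by
    have := B.constr_basis K (Sum.elim (fun l => C (X l)) X : _ → M) (Sum.inl l)
    rwa [hB] at this
  have hℓz : ∀ i, ℓ (z i) = X i := fun i => by
    have := B.constr_basis K (Sum.elim (fun l => C (X l)) X : _ → M) (Sum.inr i)
    rwa [hB] at this
  let φ : T →ₐ[K] MvPolynomial (Fin n) K := aeval (linearForm K n ∘ y)
  let g : M →ₐ[K] MvPolynomial (Fin n) K := aevalTower φ (linearForm K n ∘ z)
  let g' : MvPolynomial (Fin n) K →ₐ[K] M := aeval fun j => ℓ (Pi.single j 1)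
  have hgC : ∀ t, g (C t) = φ t := fun t => aevalTower_C _ _ _
  have hgX : ∀ i, g (X i) = linearForm K n (z i) := fun i => aevalTower_X _ _ _
  have hφX : ∀ l, φ (X l) = linearForm K n (y l) := fun l => aeval_X _ _
  have hg'lin : ∀ v, g' (linearForm K n v) = ℓ v := by
    intro v
    have : g'.toLinearMap ∘ₗ linearForm K n = ℓ := by
      refine LinearMap.pi_ext' fun j => LinearMap.ext_ring ?_
      simp [linearForm_single, g']
    exact LinearMap.congr_fun this v
  have hgℓ : ∀ v, g (ℓ v) = linearForm K n v := by
    intro v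
    have : g.toLinearMap ∘ₗ ℓ = linearForm K n := by
      refine B.ext fun s => ?_
      rw [hB]
      rcases s with l | i
      · simp only [LinearMap.comp_apply, Sum.elim_inl, hℓy, AlgHom.toLinearMap_apply, hgC, hφX]
      · simp [hℓz, hgX]
    exact LinearMap.congr_fun this v
  have hgg' : ∀ f, g (g' f) = f := by
    intro f
    have : g.comp g' = AlgHom.id K _ := by
      refine MvPolynomial.algHom_ext fun j => ?_
      simp [g', hgℓ, linearForm_single]
    exact AlgHom.congr_fun this f
  have hg'φ : ∀ t, g' (φ t) = C t := by
    intro t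
    induction t using MvPolynomial.induction_on with
    | C r =>
      rw [← algebraMap_eq, AlgHom.commutes, AlgHom.commutes]
      rfl
    | add p q hp hq => simp [hp, hq]
    | mul_X p l hp =>
      rw [map_mul, map_mul, hp, map_mul]
      rw [hφX, hg'lin, hℓy]
  exact ⟨g, g', hgC, hgX, hgg', hg'φ, fun i => (hg'lin _).trans (hℓz i)⟩

theorem pencil_normal_form (hyz : LinearIndependent K (Sum.elim y z)) (hn : m + c = n)
    (α : Fin (c + 1) → Fin m → K) (β : Fin m → K) :
    (∀ f, ∃ q, f - affineCombination y z q ∈ linearPencilIdeal y z α β) ∧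
      ∀ q, affineCombination y z q ∈ linearPencilIdeal y z α β → q = 0 := by
  obtain ⟨g, g', hgC, hgX, hgg', hg'φ, hg'z⟩ := exists_coordinate_algHoms hyz hn
  have hφX : ∀ l, aeval (linearForm K n ∘ y) (X l : MvPolynomial (Fin m) K) =
      linearForm K n (y l) := fun l => aeval_X _ _
  generalize hφ : (aeval (linearForm K n ∘ y) :
    MvPolynomial (Fin m) K →ₐ[K] MvPolynomial (Fin n) K) = φ at hgC hg'φ hφX
  have hgaff : ∀ q, g (affineForm _ c q) = affineCombination y z q := by
    intro q
    rw [affineForm_apply, affineCombination_apply, hφ]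
    simp only [map_add, map_sum, map_mul, hgC, hgX]
  have hg'aff : ∀ q, g' (affineCombination y z q) = affineForm _ c q := by
    intro q
    rw [affineForm_apply, affineCombination_apply, hφ]
    simp only [map_add, map_sum, map_mul, hg'φ, hg'z]
  have hφlin : ∀ w : Fin m → K, φ (∑ l, w l • X l) = linearForm K n (∑ l, w l • y l) := by
    intro w
    simp only [map_sum, map_smul, hφX]
  obtain ⟨a, ha⟩ : ∃ a : Fin (c + 1) → MvPolynomial (Fin m) K,
      ∀ i, φ (a i) = linearForm K n (∑ l, α i l • y l) := ⟨_, fun i => hφlin (α i)⟩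
  obtain ⟨b, hb⟩ : ∃ b : MvPolynomial (Fin m) K, φ b = linearForm K n (∑ l, β l • y l) :=
    ⟨_, hφlin β⟩
  have hgJ : ∀ f ∈ pencilIdeal a b, g f ∈ linearPencilIdeal y z α β := by
    intro f hf
    have e : (pencilMatrix X (C ∘ a) (C b)).map g = pencilMatrix (linearForm K n ∘ z)
        (fun i => linearForm K n (∑ l, α i l • y l)) (linearForm K n (∑ l, β l • y l)) := by
      rw [pencilMatrix_map]
      congr 1
      · exact funext hgX
      · exact funext fun i => (hgC (a i)).trans (ha i)
      · exact (hgC b).trans hb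
    have := map_mem_maximalMinorsIdeal g hf
    rwa [e] at this
  have hg'J : ∀ f ∈ linearPencilIdeal y z α β, g' f ∈ pencilIdeal a b := by
    intro f hf
    have e : (pencilMatrix (linearForm K n ∘ z) (fun i => linearForm K n (∑ l, α i l • y l))
        (linearForm K n (∑ l, β l • y l))).map g' =
        pencilMatrix X (C ∘ a) (C b) := by
      rw [pencilMatrix_map]
      congr 1
      · exact funext hg'z
      · exact funext fun i => (congrArg g' (ha i)).symm.trans (hg'φ (a i))
      · exact (congrArg g' hb).symm.trans (hg'φ b)
    have := map_mem_maximalMinorsIdeal g' hf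
    rwa [e] at this
  refine ⟨fun f => ?_, fun q hq => ?_⟩
  · obtain ⟨q, hq⟩ := exists_sub_affineForm_mem a b (g' f)
    refine ⟨q, ?_⟩
    have := hgJ _ hq
    rwa [map_sub, hgg', hgaff] at this
  · have := hg'J _ hq
    rw [hg'aff] at this
    exact affineForm_mem_pencilIdeal a b q this

/-- In degree e+1 the quotient is K[y]_{e+1} plus `c` copies of K[y]_e, one for each z_i. -/
theorem hilbertFunction_eq_of_normal_form {k r : ℕ} {I : Ideal (MvPolynomial (Fin (k + 1)) K)}
    (hI : ∀ f ∈ I, ∀ d, homogeneousComponent d f ∈ I)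
    {y : Fin (r + 1) → Fin (k + 1) → K} {z : Fin c → Fin (k + 1) → K}
    (hsurj : ∀ f, ∃ q, f - affineCombination y z q ∈ I)
    (hinj : ∀ q, affineCombination y z q ∈ I → q = 0) (e : ℕ) :
    hilbertFunction I (e + 1) = (e + 1 + r).choose r + c * (e + r).choose r := by
  have hy : ∀ l, ((linearForm K (k + 1) ∘ y) l).IsHomogeneous 1 :=
    fun l => isHomogeneous_linearForm _
  let D := homogeneousSubmodule (Fin (r + 1)) K (e + 1) ×
    (Fin c → homogeneousSubmodule (Fin (r + 1)) K e)
  let incl : D →ₗ[K] MvPolynomial (Fin (r + 1)) K × (Fin c → MvPolynomial (Fin (r + 1)) K) :=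
    LinearMap.prodMap (Submodule.subtype _)
      (LinearMap.pi fun i => Submodule.subtype _ ∘ₗ LinearMap.proj i)
  have hincl : Function.Injective incl := by
    rintro ⟨p, p'⟩ ⟨q, q'⟩ h
    refine Prod.ext (Subtype.ext (congrArg Prod.fst h)) (funext fun i => Subtype.ext ?_)
    exact congrFun (congrArg Prod.snd h) i
  let Ψ : D →ₗ[K] homogeneousSubmodule (Fin (k + 1)) K (e + 1) :=
    (affineCombination y z ∘ₗ incl).codRestrict _ fun d => by
      refine IsHomogeneous.add ?_ (IsHomogeneous.sum _ _ _ fun i _ => ?_)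
      · have := IsHomogeneous.aeval d.1.2 _ hy
        rwa [one_mul] at this
      · have := (IsHomogeneous.aeval (d.2 i).2 _ hy).mul (isHomogeneous_linearForm (z i))
        rwa [one_mul] at this
  let E := (I.restrictScalars K).comap (homogeneousSubmodule (Fin (k + 1)) K (e + 1)).subtype
  have hbij : Function.Bijective (E.mkQ ∘ₗ Ψ) := by
    refine ⟨?_, fun x => ?_⟩
    · rw [← LinearMap.ker_eq_bot, LinearMap.ker_eq_bot']
      intro d hd
      rw [LinearMap.comp_apply, Submodule.mkQ_apply, Submodule.Quotient.mk_eq_zero] at hd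
      exact hincl ((hinj (incl d) hd).trans (map_zero incl).symm)
    · obtain ⟨⟨f, hf⟩, rfl⟩ := E.mkQ_surjective x
      obtain ⟨q, hq⟩ := hsurj f
      -- A normal form of a homogeneous `f` may be truncated to the right degree, since `I` is
      -- homogeneous.
      refine ⟨(⟨homogeneousComponent (e + 1) q.1, homogeneousComponent_isHomogeneous _ _⟩,
        fun i => ⟨homogeneousComponent e (q.2 i), homogeneousComponent_isHomogeneous _ _⟩), ?_⟩
      rw [eq_comm, LinearMap.comp_apply, Submodule.mkQ_apply, Submodule.mkQ_apply,
        Submodule.Quotient.eq]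
      have := hI _ hq (e + 1)
      rw [map_sub, homogeneousComponent_eq_self hf, homogeneousComponent_affineCombination] at this
      exact this
  have hfin : ∀ d, Module.Finite K (homogeneousSubmodule (Fin (r + 1)) K d) := fun d =>
    Module.Finite.iff_fg.2 (homogeneousSubmodule_fg _ _ d)
  have := (LinearEquiv.ofBijective _ hbij).finrank_eq
  rw [hilbertFunction, ← this, Module.finrank_prod, Module.finrank_pi_fintype]
  simp [finrank_homogeneousSubmodule]

end PencilHilbertFunction

/-! ### Minors of a (c+1) × 2 matrix of linear forms in codimension c -/

section LinearMinors

variable {K : Type*} [Field K] {n c : ℕ}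

/-- The two-column matrix of linear forms with the given coefficient vectors. -/
def linearFormMatrix (u v : Fin (c + 1) → Fin n → K) :
    Matrix (Fin (c + 1)) (Fin 2) (MvPolynomial (Fin n) K) :=
  Matrix.of fun i => ![linearForm K n (u i), linearForm K n (v i)]

@[simp] theorem linearFormMatrix_apply_zero (u v : Fin (c + 1) → Fin n → K) (i : Fin (c + 1)) :
    linearFormMatrix u v i 0 = linearForm K n (u i) := rfl

@[simp] theorem linearFormMatrix_apply_one (u v : Fin (c + 1) → Fin n → K) (i : Fin (c + 1)) :
    linearFormMatrix u v i 1 = linearForm K n (v i) := rfl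

theorem isHomogeneous_linearFormMatrix (u v : Fin (c + 1) → Fin n → K) (i : Fin (c + 1))
    (j : Fin 2) : (linearFormMatrix u v i j).IsHomogeneous 1 := by
  fin_cases j <;> exact isHomogeneous_linearForm _

theorem isHomogeneous_minor {N : Matrix (Fin (c + 1)) (Fin 2) (MvPolynomial (Fin n) K)}
    (hN : ∀ i j, (N i j).IsHomogeneous 1) (i j : Fin (c + 1)) :
    (N i 0 * N j 1 - N i 1 * N j 0).IsHomogeneous 2 :=
  ((hN i 0).mul (hN j 1)).sub ((hN i 1).mul (hN j 0))

theorem maximalMinorsIdeal_eq_span {R : Type*} [CommRing R] {m : ℕ}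
    (N : Matrix (Fin m) (Fin 2) R) :
    maximalMinorsIdeal N =
      Ideal.span (Set.range fun p : Fin m × Fin m => N p.1 0 * N p.2 1 - N p.1 1 * N p.2 0) := by
  refine le_antisymm ((maximalMinorsIdeal_le_iff _ _).2 fun i j => Ideal.subset_span ⟨(i, j), rfl⟩)
    (Ideal.span_le.2 ?_)
  rintro _ ⟨p, rfl⟩
  exact minor_mem_maximalMinorsIdeal N _ _

theorem homogeneousComponent_mem_maximalMinorsIdeal
    {N : Matrix (Fin (c + 1)) (Fin 2) (MvPolynomial (Fin n) K)}
    (hN : ∀ i j, (N i j).IsHomogeneous 1) {f : MvPolynomial (Fin n) K}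
    (hf : f ∈ maximalMinorsIdeal N) (d : ℕ) :
    homogeneousComponent d f ∈ maximalMinorsIdeal N := by
  let _ := gradedAlgebra (σ := Fin n) (R := K)
  refine homogeneousComponent_mem_of_mem ?_ hf d
  rw [maximalMinorsIdeal_eq_span]
  refine Ideal.homogeneous_span (homogeneousSubmodule (Fin n) K) _ ?_
  rintro _ ⟨p, rfl⟩
  exact ⟨2, isHomogeneous_minor hN _ _⟩

/-- The generators are quadrics, so no element has a term of degree below two. -/
theorem eq_zero_of_mem_maximalMinorsIdeal_of_isHomogeneous_one
    {N : Matrix (Fin (c + 1)) (Fin 2) (MvPolynomial (Fin n) K)}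
    (hN : ∀ i j, (N i j).IsHomogeneous 1) {f : MvPolynomial (Fin n) K}
    (hf : f ∈ maximalMinorsIdeal N) (h1 : f.IsHomogeneous 1) : f = 0 := by
  classical
  rw [maximalMinorsIdeal_eq_span] at hf
  have key : ∀ d : Fin n →₀ ℕ, d.degree < 2 → coeff d f = 0 := by
    refine Submodule.span_induction ?_ ?_ ?_ ?_ hf
    · rintro _ ⟨p, rfl⟩ d hd
      exact (isHomogeneous_minor hN _ _).coeff_eq_zero hd.ne
    · simp
    · intro f g _ _ hf hg d hd
      rw [coeff_add, hf d hd, hg d hd, add_zero]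
    · intro a f _ hf d hd
      rw [smul_eq_mul, coeff_mul]
      refine Finset.sum_eq_zero fun x hx => ?_
      have hx' := congrArg Finsupp.degree (Finset.HasAntidiagonal.mem_antidiagonal.1 hx)
      rw [map_add] at hx'
      rw [hf x.2 (by omega), mul_zero]
  ext d
  rw [coeff_zero]
  by_cases hd : d.degree < 2
  · exact key d hd
  · exact h1.coeff_eq_zero (by omega)

theorem eval_maximalMinorsIdeal_linearFormMatrix (u v : Fin (c + 1) → Fin n → K)
    (x : Fin n → K) :
    (∀ f ∈ maximalMinorsIdeal (linearFormMatrix u v), eval x f = 0) ↔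
      ∀ i j, (u i ⬝ᵥ x) * (v j ⬝ᵥ x) = (v i ⬝ᵥ x) * (u j ⬝ᵥ x) := by
  have := maximalMinorsIdeal_le_iff (linearFormMatrix u v) (RingHom.ker (eval x))
  refine (show _ ↔ _ from this).trans (forall_congr' fun i => forall_congr' fun j => ?_)
  rw [RingHom.mem_ker, map_sub, map_mul, map_mul, sub_eq_zero]
  simp only [linearFormMatrix_apply_zero, linearFormMatrix_apply_one, eval_linearForm]

theorem linearIndependent_sumElim_ker {V W ι κ : Type*} [AddCommGroup V] [Module K V]
    [AddCommGroup W] [Module K W] [Fintype ι] [Fintype κ] {f : V →ₗ[K] W} {y : ι → V} {z : κ → V}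
    (hy : LinearIndependent K y) (hfy : ∀ i, f (y i) = 0) (hz : LinearIndependent K (f ∘ z)) :
    LinearIndependent K (Sum.elim y z) := by
  rw [Fintype.linearIndependent_iff] at hy hz ⊢
  intro g hg
  rw [Fintype.sum_sum_type] at hg
  simp only [Sum.elim_inl, Sum.elim_inr] at hg
  have h1 : ∀ i, g (Sum.inr i) = 0 := hz (fun i => g (Sum.inr i)) <| by
    have := congrArg f hg
    simpa [hfy] using this
  have h2 : ∀ i, g (Sum.inl i) = 0 := hy (fun i => g (Sum.inl i)) <| by simpa [h1] using hg
  rintro (i | i)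
  exacts [h2 i, h1 i]

/-- The ideal of `2 × 2` minors of a `(c+1) × 2` matrix of linear forms of codimension `c`
is the ideal of minors of a pencil matrix in suitable coordinates. -/
theorem exists_linearPencilIdeal_eq [IsAlgClosed K] {m : ℕ} (u v : Fin (c + 1) → Fin n → K)
    (hn : m + c = n)
    (hdim : ringKrullDim
      (MvPolynomial (Fin n) K ⧸ maximalMinorsIdeal (linearFormMatrix u v)) ≤ m) :
    ∃ (y : Fin m → Fin n → K) (z : Fin c → Fin n → K) (α : Fin (c + 1) → Fin m → K)
      (β : Fin m → K), LinearIndependent K (Sum.elim y z) ∧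
      maximalMinorsIdeal (linearFormMatrix u v) = linearPencilIdeal y z α β := by
  obtain ⟨y₀, hy₀⟩ := exists_linear_parameters m (maximalMinorsIdeal (linearFormMatrix u v))
    (fun x hx t => by
      rw [eval_maximalMinorsIdeal_linearFormMatrix] at hx ⊢
      intro i j
      simp only [dotProduct_smul, smul_eq_mul]
      linear_combination t ^ 2 * hx i j) hdim
  simp only [eval_maximalMinorsIdeal_linearFormMatrix] at hy₀
  let ε : (Fin n → K) →ₗ[K] (Fin m → K) := (Matrix.of y₀).mulVecLin
  -- The m equations `y₀` leave a space of dimension at least n - m = c; c independent vectors of it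
  -- become the columns of `Z`.
  have hε : c ≤ Module.finrank K (LinearMap.ker ε) := by
    have h1 := ε.finrank_range_add_finrank_ker
    have h2 := Submodule.finrank_le (LinearMap.range ε)
    rw [Module.finrank_fin_fun] at h1 h2
    omega
  obtain ⟨ζ, hζ⟩ := exists_linearIndependent_of_le_finrank hε
  let Z : Matrix (Fin n) (Fin c) K := Matrix.of fun j i => (ζ i).1 j
  have hZ : ∀ w, Z.mulVec w = ∑ i, w i • (ζ i).1 := fun w => by
    ext j
    simp [Matrix.mulVec, dotProduct, Z, mul_comm]
  have hZ0 : ∀ w, Z.mulVec w = 0 → w = 0 := fun w hw => by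
    rw [hZ] at hw
    refine funext (Fintype.linearIndependent_iff.1 hζ w (Subtype.ext ?_))
    simpa using hw
  have hZy : ∀ w l, y₀ l ⬝ᵥ Z.mulVec w = 0 := fun w l => by
    have : ε (∑ i, w i • (ζ i).1) = 0 := by
      rw [map_sum]
      exact Finset.sum_eq_zero fun i _ => by rw [map_smul, LinearMap.mem_ker.1 (ζ i).2, smul_zero]
    rw [hZ]
    exact congrFun this l
  let U := Matrix.of u
  let V := Matrix.of v
  -- If U Z w and V Z w are proportional, all minors vanish at Z w, as do the forms `y₀`; hence Z w
  -- = 0.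
  obtain ⟨L, hL, h0, hlast, hstep, hind⟩ := exists_chain (U * Z) (V * Z) (fun w hw => by
    refine hZ0 w (hy₀ _ (fun i j => ?_) (hZy w))
    have := hw i j
    rw [← Matrix.mulVec_mulVec, ← Matrix.mulVec_mulVec] at this
    exact this.trans (mul_comm _ _))
  -- Restriction of linear forms to the column space of `Z`.
  let res : (Fin n → K) →ₗ[K] (Fin c → K) := Z.vecMulLinear
  have hres : ∀ (A : Matrix (Fin (c + 1)) (Fin n) K) i, (L * (A * Z)) i = res ((L * A) i) := by
    intro A i
    rw [← Matrix.mul_assoc, Matrix.mul_apply_eq_vecMul]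
    rfl
  simp only [hres] at h0 hlast hstep hind
  let z : Fin c → Fin n → K := fun i => (L * V) i.succ
  have hsurj : LinearMap.range res = ⊤ := by
    have := hind.span_eq_top_of_card_eq_finrank' (by simp)
    rw [eq_top_iff, ← this, Submodule.span_le]
    rintro _ ⟨i, rfl⟩
    exact ⟨_, rfl⟩
  have hker : Module.finrank K (LinearMap.ker res) = m := by
    have h1 := res.finrank_range_add_finrank_ker
    rw [hsurj, finrank_top, Module.finrank_fin_fun, Module.finrank_fin_fun] at h1
    omega
  -- The final y are a basis of all forms vanishing on that space, not the `y₀` used to find it.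
  -- What the normal form leaves undetermined in N lies in their span.
  let B := Module.finBasisOfFinrankEq K (LinearMap.ker res) hker
  let y : Fin m → Fin n → K := fun l => (B l).1
  have hcoord : ∀ w, res w = 0 → ∃ γ : Fin m → K, w = ∑ l, γ l • y l := by
    intro w hw
    refine ⟨fun l => B.repr ⟨w, hw⟩ l, ?_⟩
    have := congrArg (Submodule.subtype _) (B.sum_repr ⟨w, hw⟩)
    rw [map_sum] at this
    exact this.symm
  have ha : ∀ i, ∃ γ : Fin m → K,
      (L * U) i - Fin.snoc (α := fun _ => Fin n → K) z 0 i = ∑ l, γ l • y l := by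
    intro i
    refine hcoord _ ?_
    refine Fin.lastCases ?_ (fun i => ?_) i
    · rw [Fin.snoc_last, sub_zero, hlast]
    · rw [Fin.snoc_castSucc, map_sub, hstep, sub_self]
  choose α hα using ha
  obtain ⟨β, hβ⟩ := hcoord _ h0
  refine ⟨y, z, α, β, ?_, ?_⟩
  · refine linearIndependent_sumElim_ker (f := res) ?_ (fun l => (B l).2) hind
    exact B.linearIndependent.map' (Submodule.subtype _) (Submodule.ker_subtype _)
  · obtain ⟨M, hM⟩ := hL.exists_left_inv
    rw [← maximalMinorsIdeal_mul_eq (L.map C) (M.map C)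
      (by rw [← Matrix.map_mul, hM, Matrix.map_one _ C_0 C_1]) (linearFormMatrix u v)]
    unfold linearPencilIdeal
    congr 1
    have hlin : ∀ (A : Matrix (Fin (c + 1)) (Fin n) K) i,
        ∑ j, C (L i j) * linearForm K n (A j) = linearForm K n ((L * A) i) := by
      intro A i
      rw [Matrix.mul_apply_eq_vecMul, Matrix.vecMul_eq_sum, map_sum]
      exact Finset.sum_congr rfl fun j _ => by rw [map_smul, smul_eq_C_mul]
    ext1 i j
    rw [Matrix.mul_apply]
    fin_cases j
    · simp only [Fin.zero_eta, linearFormMatrix_apply_zero, Matrix.map_apply]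
      refine (hlin U i).trans ?_
      rw [← sub_add_cancel ((L * U) i) (Fin.snoc (α := fun _ => Fin n → K) z 0 i), hα, map_add,
        add_comm]
      refine Fin.lastCases ?_ (fun i => ?_) i
      · simp
      · simp
    · simp only [Fin.mk_one, linearFormMatrix_apply_one, Matrix.map_apply]
      refine (hlin V i).trans ?_
      refine Fin.cases ?_ (fun i => ?_) i
      · rw [hβ, pencilMatrix_zero_one]
      · rw [pencilMatrix_succ_one]; rfl

theorem hasDegree_maximalMinorsIdeal [IsAlgClosed K] {k r : ℕ} (hr : r + c = k)
    (u v : Fin (c + 1) → Fin (k + 1) → K)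
    (hdim : HasProjDim (maximalMinorsIdeal (linearFormMatrix u v)) r) :
    HasDegree (maximalMinorsIdeal (linearFormMatrix u v)) (c + 1) := by
  obtain ⟨y, z, α, β, hyz, hI⟩ := exists_linearPencilIdeal_eq (m := r + 1) u v (by omega)
    (le_of_eq hdim)
  obtain ⟨hsurj, hinj⟩ := pencil_normal_form hyz (by omega) α β
  rw [← hI] at hsurj hinj
  have hHF := hilbertFunction_eq_of_normal_form (fun f hf d =>
    homogeneousComponent_mem_maximalMinorsIdeal (isHomogeneous_linearFormMatrix u v) hf d)
    hsurj hinj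
  -- The polynomial C(d+r, r) + c C(d-1+r, r); each summand has leading coefficient 1/r! before
  -- scaling by c.
  let p : Polynomial ℚ := Polynomial.preHilbertPoly ℚ r 0 + (c : ℚ) • Polynomial.preHilbertPoly ℚ r 1
  have hcoeff : p.coeff r = ((c + 1 : ℕ) : ℚ) / r.factorial := by
    simp only [p, Polynomial.coeff_add, Polynomial.coeff_smul,
      Polynomial.coeff_preHilbertPoly_self, smul_eq_mul]
    push_cast
    ring
  have hne : p.coeff r ≠ 0 := by
    rw [hcoeff]
    positivity
  have hdeg : p.natDegree = r := by
    refine le_antisymm ?_ (Polynomial.le_natDegree_of_ne_zero hne)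
    refine (Polynomial.natDegree_add_le _ _).trans (max_le ?_ ?_)
    · rw [Polynomial.natDegree_preHilbertPoly]
    · exact (Polynomial.natDegree_smul_le _ _).trans (Polynomial.natDegree_preHilbertPoly _ _ _).le
  refine ⟨r, p, hdim, ?_, hdeg, ?_⟩
  · filter_upwards [Filter.eventually_ge_atTop 1] with d hd
    obtain ⟨e, rfl⟩ := Nat.exists_eq_add_of_le' hd
    rw [hHF]
    simp only [p, Polynomial.eval_add, Polynomial.eval_smul, smul_eq_mul]
    rw [Polynomial.preHilbertPoly_eq_choose_sub_add ℚ r (Nat.zero_le _),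
      Polynomial.preHilbertPoly_eq_choose_sub_add ℚ r (Nat.le_add_left 1 e)]
    simp
  · rw [Polynomial.leadingCoeff, hdeg, hcoeff]

end LinearMinors

/-! ### The critical locus as a zero locus -/

section ZeroLocus

variable {K : Type*} [Field K] {k n : ℕ} {h : Fin n → ℕ}

theorem IsProfile.card_eq {α : Fin n → ℕ} (hα : IsProfile k h α) :
    Fintype.card (Σ i, Fin (h i + 1)) =
      Fintype.card (Fin (k + 1) ⊕ Σ i, (Unit ⊕ Fin (h i - α i))) := by
  simp only [Fintype.card_sigma, Fintype.card_sum, Fintype.card_fin, Fintype.card_unit]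
  rw [← hα.2, ← Finset.sum_add_distrib]
  refine Finset.sum_congr rfl fun i _ => ?_
  have := hα.1 i
  omega

/-- The matrix `(Q x | S')`. -/
def pointMatrix {h m : ℕ} (Q : Camera K k h) (S' : Matrix (Fin (h + 1)) (Fin m) K)
    (x : Fin (k + 1) → K) : Matrix (Fin (h + 1)) (Unit ⊕ Fin m) K :=
  Matrix.fromCols (Matrix.of fun a _ => Q.mat.mulVec x a) S'

theorem spanMatrix_map_eval {h m : ℕ} (Q : Camera K k h) (S' : Matrix (Fin (h + 1)) (Fin m) K)
    (x : Fin (k + 1) → K) : (spanMatrix Q S').map (eval x) = pointMatrix Q S' x := by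
  ext a (b | b)
  · simp [spanMatrix, pointMatrix, Camera.forms, Matrix.mulVec, dotProduct]
  · simp [spanMatrix, pointMatrix]

theorem grassmannMatrix_map_eval (P Q : ∀ i, Camera K k (h i)) {m : Fin n → ℕ}
    (S' : ∀ i, Matrix (Fin (h i + 1)) (Fin (m i)) K) (x : Fin (k + 1) → K) :
    (grassmannMatrix P fun i => spanMatrix (Q i) (S' i)).map (eval x) =
      Matrix.fromCols (Matrix.of fun r j => (P r.1).mat r.2 j)
        (Matrix.blockDiagonal' fun i => pointMatrix (Q i) (S' i) x) := by
  ext r (j | j)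
  · simp [grassmannMatrix]
  · simp only [grassmannMatrix, Matrix.map_apply, Matrix.fromCols_apply_inr]
    rw [← Matrix.map_apply (f := eval x), Matrix.blockDiagonal'_map _ _ (map_zero _)]
    simp only [spanMatrix_map_eval]

theorem blockDiagonal'_mulVec {ι : Type*} [Fintype ι] [DecidableEq ι] {m n : ι → Type*}
    [∀ i, Fintype (n i)] (M : ∀ i, Matrix (m i) (n i) K) (s : (Σ i, n i) → K) (i : ι) (a : m i) :
    (Matrix.blockDiagonal' M).mulVec s ⟨i, a⟩ = (M i).mulVec (fun b => s ⟨i, b⟩) a := by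
  rw [Matrix.mulVec, dotProduct, Fintype.sum_sigma, Finset.sum_eq_single i]
  · simp [Matrix.mulVec, dotProduct]
  · intro j _ hj
    exact Finset.sum_eq_zero fun b _ => by
      rw [Matrix.blockDiagonal'_apply_ne _ _ _ hj.symm, zero_mul]
  · simp

/-- The Grassmann tensor vanishes at a point if and only if the subspaces spanned by the given
points have a nontrivial common preimage, or the points are dependent. -/
theorem eval_det_grassmannMatrix_eq_zero_iff (P Q : ∀ i, Camera K k (h i)) {m : Fin n → ℕ}
    (S' : ∀ i, Matrix (Fin (h i + 1)) (Fin (m i)) K)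
    (e : (Σ i, Fin (h i + 1)) ≃ (Fin (k + 1) ⊕ Σ i, (Unit ⊕ Fin (m i)))) (x : Fin (k + 1) → K) :
    eval x ((grassmannMatrix P fun i => spanMatrix (Q i) (S' i)).submatrix id e).det = 0 ↔
      ∃ (y : Fin (k + 1) → K) (s : ∀ i, Unit ⊕ Fin (m i) → K), (y ≠ 0 ∨ ∃ i, s i ≠ 0) ∧
        ∀ i, (P i).mat.mulVec y + (pointMatrix (Q i) (S' i) x).mulVec (s i) = 0 := by
  rw [RingHom.map_det, RingHom.mapMatrix_apply, ← Matrix.submatrix_map, grassmannMatrix_map_eval,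
    ← Matrix.exists_mulVec_eq_zero_iff]
  set G := Matrix.fromCols (Matrix.of fun (r : Σ i, Fin (h i + 1)) j => (P r.1).mat r.2 j)
        (Matrix.blockDiagonal' fun i => pointMatrix (Q i) (S' i) x) with hG
  have hmul : ∀ (y : Fin (k + 1) → K) (s : (Σ i, (Unit ⊕ Fin (m i))) → K) (i : Fin n)
      (a : Fin (h i + 1)), G.mulVec (Sum.elim y s) ⟨i, a⟩ = ((P i).mat.mulVec y +
        (pointMatrix (Q i) (S' i) x).mulVec (fun b => s ⟨i, b⟩)) a := by
    intro y s i a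
    rw [hG, Matrix.fromCols_mulVec_sumElim, Pi.add_apply, Pi.add_apply, blockDiagonal'_mulVec]
    rfl
  have hsub : ∀ v : (Σ i, Fin (h i + 1)) → K,
      (G.submatrix id e).mulVec v = G.mulVec (v ∘ e.symm) := by
    intro v
    rw [Matrix.submatrix_mulVec_equiv]
    rfl
  constructor
  · rintro ⟨v, hv, hv0⟩
    rw [hsub] at hv0
    set w := v ∘ e.symm with hw
    have hwne : w ≠ 0 := fun h0 => hv (funext fun r => by
      have := congrFun h0 (e r)
      simpa [hw] using this)
    refine ⟨w ∘ Sum.inl, fun i b => w (Sum.inr ⟨i, b⟩), ?_, fun i => funext fun a => ?_⟩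
    · by_contra! hcon
      refine hwne (funext fun t => ?_)
      rcases t with j | ⟨i, b⟩
      · exact congrFun hcon.1 j
      · exact congrFun (hcon.2 i) b
    · have h1 := hmul (w ∘ Sum.inl) (w ∘ Sum.inr) i a
      rw [Sum.elim_comp_inl_inr, hv0] at h1
      exact h1.symm
  · rintro ⟨y, s, hne, h0⟩
    let w : (Fin (k + 1) ⊕ Σ i, (Unit ⊕ Fin (m i))) → K := Sum.elim y fun t => s t.1 t.2
    refine ⟨w ∘ e, fun hw => ?_, ?_⟩
    · have hw0 : ∀ t, w t = 0 := fun t => by simpa using congrFun hw (e.symm t)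
      rcases hne with hy | ⟨i, hi⟩
      · exact hy (funext fun j => hw0 (Sum.inl j))
      · exact hi (funext fun b => hw0 (Sum.inr ⟨i, b⟩))
    · rw [hsub, Function.comp_assoc, Equiv.self_comp_symm, Function.comp_id]
      funext r
      obtain ⟨i, a⟩ := r
      rw [hmul]
      exact congrFun (h0 i) a

theorem pointMatrix_mulVec {h m : ℕ} (Q : Camera K k h) (S' : Matrix (Fin (h + 1)) (Fin m) K)
    (x : Fin (k + 1) → K) (s : Unit ⊕ Fin m → K) :
    (pointMatrix Q S' x).mulVec s = s (Sum.inl ()) • Q.mat.mulVec x +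
      S'.mulVec (s ∘ Sum.inr) := by
  rw [pointMatrix, Matrix.fromCols_mulVec]
  congr 1
  funext a
  simp [Matrix.mulVec, dotProduct, mul_comm]

theorem exists_linearIndependent_extending {V : Type*} [AddCommGroup V] [Module K V]
    [Module.Finite K V] {v : V} (hv : v ≠ 0) {m : ℕ} (hm : m + 1 ≤ Module.finrank K V) :
    ∃ f : Fin (m + 1) → V, f 0 = v ∧ LinearIndependent K f := by
  induction m with
  | zero =>
    have : Subsingleton (Fin (0 + 1)) := inferInstanceAs (Subsingleton (Fin 1))
    exact ⟨fun _ => v, rfl, LinearIndependent.of_subsingleton 0 hv⟩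
  | succ m ih =>
    obtain ⟨f, hf0, hf⟩ := ih (by omega)
    obtain ⟨x, hx⟩ := exists_linearIndependent_snoc_of_lt_finrank hf (by omega)
    exact ⟨Fin.snoc f x, by rw [← hf0]; exact Fin.snoc_castSucc (α := fun _ => V) x f 0, hx⟩

theorem exists_pointMatrix {h m : ℕ} (Q : Camera K k h) {x : Fin (k + 1) → K}
    {L : Submodule K (Fin (h + 1) → K)} (hx : Q.mat.mulVec x ∈ L) (hne : Q.mat.mulVec x ≠ 0)
    (hm : Module.finrank K L = m + 1) :
    ∃ S' : Matrix (Fin (h + 1)) (Fin m) K, (∀ s, (pointMatrix Q S' x).mulVec s ∈ L) ∧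
      ∀ s, (pointMatrix Q S' x).mulVec s = 0 → s = 0 := by
  obtain ⟨f, hf0, hf⟩ := exists_linearIndependent_extending (K := K) (v := (⟨_, hx⟩ : L))
    (fun h0 => hne (congrArg Subtype.val h0)) hm.ge
  let S' : Matrix (Fin (h + 1)) (Fin m) K := Matrix.of fun a b => (f b.succ).1 a
  have hmul : ∀ s, (pointMatrix Q S' x).mulVec s =
      (∑ i, (Fin.cons (s (Sum.inl ())) (s ∘ Sum.inr) : Fin (m + 1) → K) i • f i : L) := by
    intro s
    rw [pointMatrix_mulVec, Fin.sum_univ_succ, hf0]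
    ext a
    simp [Matrix.mulVec, dotProduct, S', mul_comm]
  refine ⟨S', fun s => ?_, fun s hs => ?_⟩
  · rw [hmul]
    exact Submodule.coe_mem _
  · rw [hmul] at hs
    have h0 := Fintype.linearIndependent_iff.1 hf _ (Subtype.ext hs)
    funext t
    rcases t with ⟨⟩ | b
    · exact h0 0
    · simpa using h0 b.succ

/-- The critical locus is the zero locus of the critical ideal. -/
theorem mem_criticalLocus_iff (P Q : ∀ i, Camera K k (h i))
    (x : Projectivization K (Fin (k + 1) → K)) :
    x ∈ criticalLocus P Q ↔ ∀ f ∈ criticalIdeal P Q, eval x.rep f = 0 := by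
  have hspan : (∀ f ∈ criticalIdeal P Q, eval x.rep f = 0) ↔
      criticalIdeal P Q ≤ RingHom.ker (eval x.rep) := Iff.rfl
  rw [hspan, criticalIdeal, Ideal.span_le]
  constructor
  · rintro hx _ ⟨α, hα, S', e, rfl⟩
    refine (eval_det_grassmannMatrix_eq_zero_iff P Q S' e x.rep).2 ?_
    -- Dependent columns within one block give a kernel vector with y = 0; otherwise the columns
    -- span subspaces of codimension exactly α_i.
    by_cases hdep : ∃ i s, s ≠ 0 ∧ (pointMatrix (Q i) (S' i) x.rep).mulVec s = 0
    · obtain ⟨i, s, hs, h0⟩ := hdep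
      refine ⟨0, Pi.single i s, Or.inr ⟨i, by simpa using hs⟩, fun j => ?_⟩
      rw [Matrix.mulVec_zero, zero_add]
      by_cases hj : j = i
      · subst hj
        rwa [Pi.single_eq_same]
      · rw [Pi.single_eq_of_ne hj, Matrix.mulVec_zero]
    · push Not at hdep
      have hinj : ∀ i, Function.Injective (pointMatrix (Q i) (S' i) x.rep).mulVecLin := fun i => by
        rw [← LinearMap.ker_eq_bot, LinearMap.ker_eq_bot']
        intro s hs
        by_contra hne
        exact hdep i s hne hs
      let u : ∀ i, Unit ⊕ Fin (h i - α i) → K := fun i => Pi.single (Sum.inl ()) 1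
      have hu : ∀ i, (pointMatrix (Q i) (S' i) x.rep).mulVec (u i) = (Q i).mat.mulVec x.rep := by
        intro i
        funext a
        simp [u, pointMatrix]
      -- At a point of a center the column Q_i(x) is zero, against independence.
      rcases hx with ⟨i, hi⟩ | hx
      · have h1 : u i = 0 := hinj i (by
          rw [map_zero, Matrix.mulVecLin_apply, hu]
          exact hi)
        have := congrFun h1 (Sum.inl ())
        simp [u] at this
      · obtain ⟨y, hy, hyL⟩ := hx α hα
          (fun i => LinearMap.range (pointMatrix (Q i) (S' i) x.rep).mulVecLin)
          (fun i => by
            rw [LinearMap.finrank_range_of_inj (hinj i)]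
            have := hα.1 i
            simp
            omega)
          (fun i => ⟨u i, hu i⟩)
        choose s hs using hyL
        refine ⟨y, fun i => -s i, Or.inl hy, fun i => ?_⟩
        rw [Matrix.mulVec_neg, ← hs i, Matrix.mulVecLin_apply, add_neg_cancel]
  · intro hf
    by_cases hc : ∃ i, x.rep ∈ (Q i).center
    · exact Or.inl hc
    · push Not at hc
      refine Or.inr fun α hα L hL hQL => ?_
      -- Complete Q_i(x) ≠ 0 to a basis of L_i; independence of its members then excludes a kernel
      -- vector with y = 0.
      have hex := fun i => exists_pointMatrix (m := h i - α i) (Q i) (hQL i) (hc i) (by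
        have := hL i
        have := hα.1 i
        omega)
      choose S' hS'L hS' using hex
      obtain ⟨e⟩ : Nonempty ((Σ i, Fin (h i + 1)) ≃
          (Fin (k + 1) ⊕ Σ i, (Unit ⊕ Fin (h i - α i)))) := ⟨Fintype.equivOfCardEq hα.card_eq⟩
      obtain ⟨y, s, hne, h0⟩ := (eval_det_grassmannMatrix_eq_zero_iff P Q S' e x.rep).1
        (hf ⟨α, hα, S', e, rfl⟩)
      refine ⟨y, fun hy => ?_, fun i => ?_⟩
      · rcases hne with hne | ⟨i, hi⟩
        · exact hne hy
        · have := h0 i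
          rw [hy, Matrix.mulVec_zero, zero_add] at this
          exact hi (hS' i _ this)
      · rw [eq_neg_of_add_eq_zero_left (h0 i)]
        exact (L i).neg_mem (hS'L i _)

end ZeroLocus

/-! ### Determinants with two proportional columns -/

section Determinants

/-- Modulo `J` the two columns have vanishing minors, so in the Leibniz formula the terms of σ and σ
∘ (p q) cancel. -/
theorem det_mem_of_two_columns {R τ : Type*} [CommRing R] [Fintype τ] [DecidableEq τ]
    (M : Matrix τ τ R) {p q : τ} (hpq : p ≠ q) (J : Ideal R)
    (hJ : ∀ r s, M r p * M s q - M r q * M s p ∈ J) : M.det ∈ J := by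
  rw [← Ideal.Quotient.eq_zero_iff_mem, RingHom.map_det, Matrix.det_apply]
  set N := (Ideal.Quotient.mk J).mapMatrix M with hN
  have hNpq : ∀ r s, N r p * N s q = N r q * N s p := fun r s => by
    have := Ideal.Quotient.eq_zero_iff_mem.2 (hJ r s)
    rw [map_sub, map_mul, map_mul, sub_eq_zero] at this
    exact this
  refine Finset.sum_involution (fun σ _ => σ * Equiv.swap p q) (fun σ _ => ?_) (fun σ _ _ => ?_)
    (fun σ _ => Finset.mem_univ _) (fun σ _ => ?_)
  · have hprod : ∏ i, N ((σ * Equiv.swap p q) i) i = ∏ i, N (σ i) i := by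
      have hsplit : ∀ f : τ → R ⧸ J, ∏ i, f i =
          f p * (f q * ∏ i ∈ (Finset.univ.erase p).erase q, f i) := by
        intro f
        rw [Finset.mul_prod_erase _ _ (Finset.mem_erase.2 ⟨hpq.symm, Finset.mem_univ _⟩),
          Finset.mul_prod_erase _ _ (Finset.mem_univ _)]
      rw [hsplit, hsplit, ← mul_assoc, ← mul_assoc]
      congr 1
      · simp only [Equiv.Perm.mul_apply, Equiv.swap_apply_left, Equiv.swap_apply_right]
        rw [hNpq, mul_comm]
      · refine Finset.prod_congr rfl fun i hi => ?_
        rw [Finset.mem_erase, Finset.mem_erase] at hi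
        rw [Equiv.Perm.mul_apply, Equiv.swap_apply_of_ne_of_ne hi.2.1 hi.1]
    rw [hprod, Equiv.Perm.sign_mul, Equiv.Perm.sign_swap hpq]
    simp
  · intro h
    have := mul_eq_left.1 h
    exact hpq (Equiv.swap_eq_one_iff.1 this)
  · rw [mul_assoc, Equiv.swap_mul_self, mul_one]

theorem exists_equiv_apply_eq_apply_eq {α β : Type*} [Fintype α] [Fintype β]
    (hcard : Fintype.card α = Fintype.card β) {x₀ x₁ : α} (hx : x₀ ≠ x₁) {r₀ r₁ : β}
    (hr : r₀ ≠ r₁) : ∃ g : α ≃ β, g x₀ = r₀ ∧ g x₁ = r₁ := by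
  classical
  let g₀ := Fintype.equivOfCardEq hcard
  let g₁ := g₀.trans (Equiv.swap (g₀ x₀) r₀)
  have h₁ : g₁ x₀ = r₀ := by simp [g₁]
  refine ⟨g₁.trans (Equiv.swap (g₁ x₁) r₁), ?_, by simp⟩
  rw [Equiv.trans_apply, h₁, Equiv.swap_apply_of_ne_of_ne _ hr]
  rw [← h₁]
  exact fun h => hx (g₁.injective h)

end Determinants

/-! ### The critical ideal as an ideal of 2 × 2 minors -/

section CriticalIdeal

variable {K : Type*} [Field K] {k : ℕ}

theorem Camera.eq_zero_of_vecMul_eq_zero {h : ℕ} (P : Camera K k h) {w : Fin (h + 1) → K}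
    (hw : Matrix.vecMul w P.mat = 0) : w = 0 := by
  have hrange : LinearMap.range P.mat.mulVecLin = ⊤ := by
    refine Submodule.eq_top_of_finrank_eq ?_
    rw [Module.finrank_fin_fun]
    exact P.rank_mat
  refine dotProduct_eq_zero _ fun v => ?_
  obtain ⟨x, rfl⟩ := LinearMap.range_eq_top.1 hrange v
  rw [Matrix.mulVecLin_apply, Matrix.dotProduct_mulVec, hw, zero_dotProduct]

/-- The matrix with the blocks `P_i` stacked on top of each other. -/
def stackMatrix {n : ℕ} {h : Fin n → ℕ} (P : ∀ i, Camera K k (h i)) :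
    Matrix (Σ i, Fin (h i + 1)) (Fin (k + 1)) K :=
  Matrix.of fun r j => (P r.1).mat r.2 j

/-- Complete the columns of `M` to a basis by lifting a basis of the quotient; `F` is the matrix of
this basis and `E` its inverse. The lower rows of `E` form a basis of the left kernel of `M`. -/
theorem exists_mul_eq_fromRows_one_zero {n c : ℕ} {ρ : Type*} [Fintype ρ] [DecidableEq ρ]
    (M : Matrix ρ (Fin n) K) (hM : ∀ y, M.mulVec y = 0 → y = 0)
    (hcard : Fintype.card ρ = n + c) :
    ∃ (E : Matrix (Fin n ⊕ Fin c) ρ K) (F : Matrix ρ (Fin n ⊕ Fin c) K),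
      E * F = 1 ∧ E * M = Matrix.fromRows 1 0 := by
  have hcol : LinearIndependent K M.col := by
    rw [Fintype.linearIndependent_iff]
    intro g hg
    refine congrFun (hM g ?_)
    funext r
    have := congrFun hg r
    simpa [Matrix.mulVec, dotProduct, mul_comm] using this
  let W := Submodule.span K (Set.range M.col)
  have hW : Module.finrank K W = n := by
    rw [finrank_span_eq_card hcol, Fintype.card_fin]
  have hquot : Module.finrank K ((ρ → K) ⧸ W) = c := by
    have := W.finrank_quotient_add_finrank
    rw [Module.finrank_fintype_fun_eq_card] at this
    omega
  let b := Module.finBasisOfFinrankEq K _ hquot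
  choose z hz using fun i => W.mkQ_surjective (b i)
  have hli : LinearIndependent K (Sum.elim M.col z) := by
    refine linearIndependent_sumElim_ker (f := W.mkQ) hcol (fun i => ?_) ?_
    · rw [Submodule.mkQ_apply, Submodule.Quotient.mk_eq_zero]
      exact Submodule.subset_span ⟨i, rfl⟩
    · rw [show W.mkQ ∘ z = b from funext hz]
      exact b.linearIndependent
  let B : Module.Basis (Fin n ⊕ Fin c) K (ρ → K) :=
    basisOfLinearIndependentOfCardEqFinrank' _ hli (by simp [hcard])
  have hB : ∀ s, B s = Sum.elim M.col z s := fun s => by simp [B]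
  let E := B.toMatrix (Pi.basisFun K ρ)
  let F := (Pi.basisFun K ρ).toMatrix B
  have hEF : E * F = 1 := B.toMatrix_mul_toMatrix_flip _
  refine ⟨E, F, hEF, ?_⟩
  have hMF : M = F.submatrix id Sum.inl := by
    ext r j
    simp [F, Module.Basis.toMatrix_apply, hB]
  have : E * M = (E * F).submatrix id Sum.inl := by rw [hMF]; rfl
  rw [this, hEF]
  ext (i | i) j
  · simp [Matrix.one_apply]
  · simp

variable {c : ℕ} {h : Fin 2 → ℕ}

/-- The `i`-th block of columns of a matrix. -/
def columnBlock (A : Matrix (Fin (c + 1)) (Σ i, Fin (h i + 1)) K) (i : Fin 2) :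
    Matrix (Fin (c + 1)) (Fin (h i + 1)) K :=
  A.submatrix id fun a => ⟨i, a⟩

/-- If w A vanishes on block i, then A P = 0 leaves (w A)_j P_j = 0 for the other block j. The rows
of P_j are independent, so w A = 0 and w = 0: the block A_i has independent rows, hence is onto. -/
theorem columnBlock_surjective (P : ∀ i, Camera K k (h i))
    {A : Matrix (Fin (c + 1)) (Σ i, Fin (h i + 1)) K} (hAP : A * stackMatrix P = 0)
    (hA : ∀ w, Matrix.vecMul w A = 0 → w = 0) (i : Fin 2) (v : Fin (c + 1) → K) :
    ∃ s, (columnBlock A i).mulVec s = v := by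
  have hinj : ∀ w, Matrix.vecMul w (columnBlock A i) = 0 → w = 0 := by
    intro w hw
    have hwi : ∀ a, Matrix.vecMul w A ⟨i, a⟩ = 0 := fun a => congrFun hw a
    obtain ⟨j, hij, hj⟩ : ∃ j : Fin 2, j ≠ i ∧ ∀ l, l = i ∨ l = j := by
      fin_cases i
      · exact ⟨1, by decide, by decide⟩
      · exact ⟨0, by decide, by decide⟩
    have hwP : Matrix.vecMul (fun a => Matrix.vecMul w A ⟨j, a⟩) (P j).mat = 0 := by
      have h0 : Matrix.vecMul (Matrix.vecMul w A) (stackMatrix P) = 0 := by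
        rw [Matrix.vecMul_vecMul, hAP, Matrix.vecMul_zero]
      funext t
      have h1 := congrFun h0 t
      rw [Matrix.vecMul, dotProduct, Fintype.sum_sigma, Finset.sum_eq_single j] at h1
      · exact h1
      · intro l _ hl
        obtain rfl := (hj l).resolve_right hl
        exact Finset.sum_eq_zero fun a _ => by rw [hwi, zero_mul]
      · simp
    have hwj := (P j).eq_zero_of_vecMul_eq_zero hwP
    refine hA w (funext fun r => ?_)
    obtain ⟨l, a⟩ := r
    rcases hj l with rfl | rfl
    · exact hwi a
    · exact congrFun hwj a
  have hfin := finrank_add_finrank_dotPerp (LinearMap.range (columnBlock A i).mulVecLin)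
  have hperp : dotPerp (LinearMap.range (columnBlock A i).mulVecLin) = ⊥ := by
    rw [eq_bot_iff]
    intro w hw
    rw [mem_dotPerp] at hw
    refine hinj w (dotProduct_eq_zero _ fun s => ?_)
    rw [← Matrix.dotProduct_mulVec, dotProduct_comm]
    exact hw _ ⟨s, rfl⟩
  rw [hperp, finrank_bot, add_zero] at hfin
  have htop : LinearMap.range (columnBlock A i).mulVecLin = ⊤ :=
    Submodule.eq_top_of_finrank_eq (by rw [hfin, Module.finrank_fin_fun])
  exact LinearMap.range_eq_top.1 htop v

/-- The `(c+1) × 2` matrix with columns `A_i Q_i(X)`. -/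
def conjugateMatrix (A : Matrix (Fin (c + 1)) (Σ i, Fin (h i + 1)) K)
    (Q : ∀ i, Camera K k (h i)) :
    Matrix (Fin (c + 1)) (Fin 2) (MvPolynomial (Fin (k + 1)) K) :=
  linearFormMatrix (columnBlock A 0 * (Q 0).mat) (columnBlock A 1 * (Q 1).mat)

theorem conjugateMatrix_apply (A : Matrix (Fin (c + 1)) (Σ i, Fin (h i + 1)) K)
    (Q : ∀ i, Camera K k (h i)) (r : Fin (c + 1)) (i : Fin 2) :
    conjugateMatrix A Q r i = ∑ a, C (A r ⟨i, a⟩) * (Q i).forms a := by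
  have key : ∀ i, linearForm K (k + 1) ((columnBlock A i * (Q i).mat) r) =
      ∑ a, C (A r ⟨i, a⟩) * (Q i).forms a := by
    intro i
    rw [Matrix.mul_apply_eq_vecMul, Matrix.vecMul_eq_sum, map_sum]
    refine Finset.sum_congr rfl fun a _ => ?_
    rw [map_smul, smul_eq_C_mul]
    rfl
  fin_cases i
  · exact key 0
  · exact key 1

theorem mul_blockDiagonal'_apply {R ι κ : Type*} [CommRing R] [Fintype ι] [DecidableEq ι]
    {m n : ι → Type*} [∀ i, Fintype (m i)] (A : Matrix κ (Σ i, m i) R)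
    (M : ∀ i, Matrix (m i) (n i) R) (r : κ) (i : ι) (b : n i) :
    (A * Matrix.blockDiagonal' M) r ⟨i, b⟩ = ∑ a, A r ⟨i, a⟩ * M i a b := by
  rw [Matrix.mul_apply, Fintype.sum_sigma, Finset.sum_eq_single i]
  · simp
  · intro j _ hj
    exact Finset.sum_eq_zero fun a _ => by
      rw [Matrix.blockDiagonal'_apply_ne _ _ _ hj, mul_zero]
  · simp

/-- A matrix of constants, as a matrix over the coordinate ring. -/
def constantMatrix (k : ℕ) {m n : Type*} (A : Matrix m n K) :
    Matrix m n (MvPolynomial (Fin (k + 1)) K) :=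
  A.map C

theorem constantMatrix_mul {m n p : Type*} [Fintype n] (A : Matrix m n K) (B : Matrix n p K) :
    constantMatrix k A * constantMatrix k B = constantMatrix k (A * B) :=
  (Matrix.map_mul (f := (C : K →+* MvPolynomial (Fin (k + 1)) K))).symm

theorem constantMatrix_one {m : Type*} [DecidableEq m] :
    constantMatrix k (1 : Matrix m m K) = 1 :=
  Matrix.map_one _ C_0 C_1

theorem constantMatrix_zero {m n : Type*} : constantMatrix k (0 : Matrix m n K) = 0 :=
  Matrix.map_zero _ C_0

variable {P Q : ∀ i, Camera K k (h i)}
  {E : Matrix (Fin (k + 1) ⊕ Fin (c + 1)) (Σ i, Fin (h i + 1)) K}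
  {F : Matrix (Σ i, Fin (h i + 1)) (Fin (k + 1) ⊕ Fin (c + 1)) K}

/-- Multiplying by the invertible constant matrix `E` makes the Grassmann matrix block upper
triangular, with an identity block in the corner. -/
theorem det_grassmannMatrix_mem_iff (hEF : E * F = 1)
    (hEP : E * stackMatrix P = Matrix.fromRows 1 0) {τ : Fin 2 → Type} [∀ i, Fintype (τ i)]
    [∀ i, DecidableEq (τ i)]
    (S : ∀ i, Matrix (Fin (h i + 1)) (τ i) (MvPolynomial (Fin (k + 1)) K))
    (e : (Σ i, Fin (h i + 1)) ≃ (Fin (k + 1) ⊕ Σ i, τ i)) (g : (Σ i, τ i) ≃ Fin (c + 1))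
    (J : Ideal (MvPolynomial (Fin (k + 1)) K)) :
    ((grassmannMatrix P S).submatrix id e).det ∈ J ↔
      ((constantMatrix k E.toRows₂ * Matrix.blockDiagonal' S).submatrix g id).det ∈ J := by
  let e' := e.trans (Equiv.sumCongr (Equiv.refl _) g)
  have hEP₁ : E.toRows₁ * stackMatrix P = 1 := by
    have := congrArg Matrix.toRows₁ hEP
    rwa [Matrix.toRows₁_fromRows] at this
  have hEP₂ : E.toRows₂ * stackMatrix P = 0 := by
    have := congrArg Matrix.toRows₂ hEP
    rwa [Matrix.toRows₂_fromRows] at this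
  have hG : constantMatrix k E * grassmannMatrix P S = Matrix.fromBlocks 1
      (constantMatrix k E.toRows₁ * Matrix.blockDiagonal' S) 0
      (constantMatrix k E.toRows₂ * Matrix.blockDiagonal' S) := by
    have h1 : constantMatrix k E =
        Matrix.fromRows (constantMatrix k E.toRows₁) (constantMatrix k E.toRows₂) := by
      ext (i | i) j <;> rfl
    have h2 : grassmannMatrix P S =
        Matrix.fromCols (constantMatrix k (stackMatrix P)) (Matrix.blockDiagonal' S) := rfl
    rw [h1, h2, Matrix.fromRows_mul_fromCols, constantMatrix_mul, constantMatrix_mul, hEP₁, hEP₂,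
      constantMatrix_one, constantMatrix_zero]
  have hunit : IsUnit ((constantMatrix k E).submatrix e' id).det := by
    refine Matrix.isUnit_det_of_right_inverse (B := (constantMatrix k F).submatrix id e') ?_
    have h1 : (constantMatrix k E).submatrix e' id * (constantMatrix k F).submatrix id e' =
        (constantMatrix k E * constantMatrix k F).submatrix e' e' := rfl
    rw [h1, constantMatrix_mul, hEF, constantMatrix_one, Matrix.submatrix_one_equiv]
  have hdet : ((constantMatrix k E).submatrix e' id).det * ((grassmannMatrix P S).submatrix id e).det =
      ((constantMatrix k E.toRows₂ * Matrix.blockDiagonal' S).submatrix g id).det := by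
    rw [← Matrix.det_mul]
    have h3 : (constantMatrix k E).submatrix e' id * (grassmannMatrix P S).submatrix id e =
        (Matrix.fromBlocks (1 : Matrix (Fin (k + 1)) (Fin (k + 1)) _)
          (constantMatrix k E.toRows₁ * Matrix.blockDiagonal' S) 0
          ((constantMatrix k E.toRows₂ * Matrix.blockDiagonal' S).submatrix g id)).submatrix e e := by
      have h4 : (constantMatrix k E).submatrix e' id * (grassmannMatrix P S).submatrix id e =
        (constantMatrix k E * grassmannMatrix P S).submatrix e' e := rfl
      rw [h4, hG]
      ext i j
      simp only [Matrix.submatrix_apply, e', Equiv.trans_apply]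
      rcases e i with a | a <;> rcases e j with b | b <;> rfl
    rw [h3, Matrix.det_submatrix_equiv_self, Matrix.det_fromBlocks_zero₂₁, Matrix.det_one, one_mul]
  rw [← hdet]
  exact (Ideal.unit_mul_mem_iff_mem J hunit).symm

theorem criticalIdeal_eq_maximalMinorsIdeal (hlt : ∀ i, h i < k) (hsum : h 0 + h 1 = k + c)
    (hEF : E * F = 1) (hEP : E * stackMatrix P = Matrix.fromRows 1 0) :
    criticalIdeal P Q = maximalMinorsIdeal (conjugateMatrix E.toRows₂ Q) := by
  have hEP₂ : E.toRows₂ * stackMatrix P = 0 := by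
    have := congrArg Matrix.toRows₂ hEP
    rwa [Matrix.toRows₂_fromRows] at this
  have hcardτ : ∀ α : Fin 2 → ℕ, IsProfile k h α →
      Fintype.card (Fin 2 ⊕ Σ i, Fin (h i - α i)) = c + 1 := by
    intro α hα
    have h0 := hα.1 0
    have h1 := hα.1 1
    have h2 := hα.2
    rw [Fin.sum_univ_two] at h2
    simp only [Fintype.card_sum, Fintype.card_sigma, Fintype.card_fin, Fin.sum_univ_two]
    omega
  -- Regroups the columns so that the two columns coming from Q_i(X) stand first.
  let φ : ∀ m : Fin 2 → ℕ, (Fin 2 ⊕ Σ i, Fin (m i)) ≃ Σ i, (Unit ⊕ Fin (m i)) := fun m =>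
    { toFun := Sum.elim (fun i => ⟨i, Sum.inl ()⟩) fun t => ⟨t.1, Sum.inr t.2⟩
      invFun := fun t => Sum.elim (fun _ => Sum.inl t.1) (fun b => Sum.inr ⟨t.1, b⟩) t.2
      left_inv := by rintro (i | t) <;> rfl
      right_inv := by rintro ⟨i, (b | b)⟩ <;> rfl }
  have hcol0 : ∀ {m : Fin 2 → ℕ} (S' : ∀ i, Matrix (Fin (h i + 1)) (Fin (m i)) K) r i,
      (constantMatrix k E.toRows₂ * Matrix.blockDiagonal' fun i => spanMatrix (Q i) (S' i)) r
        ⟨i, Sum.inl ()⟩ = conjugateMatrix E.toRows₂ Q r i := by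
    intro m S' r i
    rw [mul_blockDiagonal'_apply, conjugateMatrix_apply]
    rfl
  have hcol1 : ∀ {m : Fin 2 → ℕ} (S' : ∀ i, Matrix (Fin (h i + 1)) (Fin (m i)) K) r i b,
      (constantMatrix k E.toRows₂ * Matrix.blockDiagonal' fun i => spanMatrix (Q i) (S' i)) r
        ⟨i, Sum.inr b⟩ = C ((columnBlock E.toRows₂ i).mulVec (fun a => S' i a b) r) := by
    intro m S' r i b
    rw [mul_blockDiagonal'_apply, Matrix.mulVec, dotProduct, map_sum]
    refine Finset.sum_congr rfl fun a _ => ?_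
    rw [C_mul]
    rfl
  refine le_antisymm (Ideal.span_le.2 ?_) ((maximalMinorsIdeal_le_iff _ _).2 fun r₀ r₁ => ?_)
  · rintro _ ⟨α, hα, S', e, rfl⟩
    have hcard : Fintype.card (Fin 2 ⊕ Σ i, Fin (h i - α i)) = Fintype.card (Fin (c + 1)) := by
      rw [hcardτ α hα, Fintype.card_fin]
    let g := (φ _).symm.trans (Fintype.equivOfCardEq hcard)
    refine (det_grassmannMatrix_mem_iff hEF hEP _ e g _).2 ?_
    refine det_mem_of_two_columns _ (p := ⟨0, Sum.inl ()⟩) (q := ⟨1, Sum.inl ()⟩) (by simp) _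
      fun r s => ?_
    simp only [Matrix.submatrix_apply, id, hcol0]
    exact minor_mem_maximalMinorsIdeal _ _ _
  · by_cases hr : r₀ = r₁
    · subst hr
      rw [mul_comm, sub_self]
      exact Ideal.zero_mem _
    -- Two distinct rows need c ≥ 1; for c = 0 there is no profile, and both ideals are zero.
    have hc : 1 ≤ c := by
      by_contra hc
      have h0 := r₀.2
      have h1 := r₁.2
      exact hr (Fin.ext (by omega))
    obtain ⟨α, hα⟩ : ∃ α, IsProfile k h α := by
      have h0 := hlt 0
      have h1 := hlt 1
      -- The sum is h 0 + h 1 - (c - 1) = k + 1. The subtraction is not truncated, since h 1 < k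
      -- forces c < h 0.
      refine ⟨![h 0 - (c - 1), h 1], fun i => ?_, ?_⟩
      · fin_cases i <;> simp
      · rw [Fin.sum_univ_two]
        simp only [Matrix.cons_val_zero, Matrix.cons_val_one]
        omega
    have hcard : Fintype.card (Fin 2 ⊕ Σ i, Fin (h i - α i)) = Fintype.card (Fin (c + 1)) := by
      rw [hcardτ α hα, Fintype.card_fin]
    -- The rows r₀ and r₁ are matched with the two columns of linear forms, the other c-1 rows with
    -- the constant columns.
    obtain ⟨g, hg0, hg1⟩ := exists_equiv_apply_eq_apply_eq hcard
      (show (Sum.inl 0 : Fin 2 ⊕ Σ i, Fin (h i - α i)) ≠ Sum.inl 1 by simp) hr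
    have hA : ∀ w, Matrix.vecMul w E.toRows₂ = 0 → w = 0 := by
      intro w hw
      have h1 : E.toRows₂ * F.toCols₂ = 1 := by
        ext i j
        have := congrFun (congrFun hEF (Sum.inr i)) (Sum.inr j)
        simpa [Matrix.one_apply, Matrix.mul_apply] using this
      rw [← Matrix.vecMul_one w, ← h1, ← Matrix.vecMul_vecMul, hw, Matrix.zero_vecMul]
    -- The further points are chosen so that A_i maps them to the standard basis vectors of the rows
    -- other than r₀, r₁; the determinant is then the minor on r₀, r₁.
    choose s hs using fun i (b : Fin (h i - α i)) =>
      columnBlock_surjective P hEP₂ hA i (Pi.single (g (Sum.inr ⟨i, b⟩)) 1)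
    let S' : ∀ i, Matrix (Fin (h i + 1)) (Fin (h i - α i)) K := fun i =>
      Matrix.of fun a b => s i b a
    obtain ⟨e⟩ : Nonempty ((Σ i, Fin (h i + 1)) ≃
        (Fin (k + 1) ⊕ Σ i, (Unit ⊕ Fin (h i - α i)))) := ⟨Fintype.equivOfCardEq hα.card_eq⟩
    have hmem : ((grassmannMatrix P fun i => spanMatrix (Q i) (S' i)).submatrix id e).det ∈
        criticalIdeal P Q := Ideal.subset_span ⟨α, hα, S', e, rfl⟩
    rw [det_grassmannMatrix_mem_iff hEF hEP _ e ((φ _).symm.trans g),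
      ← Matrix.det_submatrix_equiv_self (φ _)] at hmem
    set D := constantMatrix k E.toRows₂ * Matrix.blockDiagonal' fun i => spanMatrix (Q i) (S' i) with hD
    have hblock : (D.submatrix ((φ _).symm.trans g) id).submatrix (φ _) (φ _) =
        Matrix.fromBlocks
          (Matrix.of fun i j => conjugateMatrix E.toRows₂ Q (g (Sum.inl i)) j) 0
          (Matrix.of fun t j => conjugateMatrix E.toRows₂ Q (g (Sum.inr t)) j) 1 := by
      refine Matrix.ext fun i j => ?_
      have hφ : ((φ fun i => h i - α i).symm.trans g) ((φ _) i) = g i := by simp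
      rw [Matrix.submatrix_apply, Matrix.submatrix_apply, hφ]
      rcases j with j | ⟨j, b⟩
      · refine (hcol0 S' (g i) j).trans ?_
        rcases i with i | i <;> rfl
      · refine (hcol1 S' (g i) j b).trans ?_
        have : (columnBlock E.toRows₂ j).mulVec (fun a => S' j a b) =
          Pi.single (g (Sum.inr ⟨j, b⟩)) 1 := hs j b
        rw [this]
        rcases i with i | i
        · simp
        · simp [Pi.single_apply, Matrix.one_apply]
    rw [hblock, Matrix.det_fromBlocks_zero₁₂, Matrix.det_one, mul_one, Matrix.det_fin_two] at hmem
    simpa [hg0, hg1] using hmem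

end CriticalIdeal

end Multiview

end

theorem proposition5p1 {K : Type*} [Field K] [IsAlgClosed K] (k c : ℕ) (h : Fin 2 → ℕ)
    (hlt : ∀ i, h i < k) (hsum : h 0 + h 1 = k + c)
    (P Q : ∀ i, Multiview.Camera K k (h i)) (hgen : Multiview.GeneralCase P Q) :
    (∀ x : Projectivization K (Fin (k + 1) → K), x ∈ Multiview.criticalLocus P Q ↔
      ∀ f ∈ Multiview.criticalIdeal P Q, MvPolynomial.eval x.rep f = 0) ∧
    (∃ N : Matrix (Fin (c + 1)) (Fin 2) (MvPolynomial (Fin (k + 1)) K),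
      (∀ i j, (N i j).IsHomogeneous 1) ∧
      Multiview.criticalIdeal P Q = Multiview.maximalMinorsIdeal N) ∧
    (∃ r : ℕ, r + c = k ∧ Multiview.HasProjDim (Multiview.criticalIdeal P Q) r) ∧
    Multiview.HasDegree (Multiview.criticalIdeal P Q) (c + 1) ∧
    Multiview.IsMinimalDegree (Multiview.criticalIdeal P Q) := by
  obtain ⟨E, F, hEF, hEP⟩ := Multiview.exists_mul_eq_fromRows_one_zero (c := c + 1)
    (Multiview.stackMatrix P) (fun y hy => by
      have : y ∈ ⨅ i, (P i).center := by
        rw [Submodule.mem_iInf]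
        intro i
        exact funext fun a => congrFun hy ⟨i, a⟩
      rwa [hgen.centers_left] at this)
    (by
      simp only [Fintype.card_sigma, Fintype.card_fin, Fin.sum_univ_two]
      omega)
  have hI := Multiview.criticalIdeal_eq_maximalMinorsIdeal (Q := Q) hlt hsum hEF hEP
  have hhom := Multiview.isHomogeneous_linearFormMatrix
    (Multiview.columnBlock E.toRows₂ 0 * (Q 0).mat) (Multiview.columnBlock E.toRows₂ 1 * (Q 1).mat)
  obtain ⟨r, hr, hrk⟩ := hgen.expected_dim
  rw [Fin.sum_univ_two] at hrk
  -- The expected dimension is 2k - (k + c).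
  have hrc : r + c = k := by omega
  have hdeg : Multiview.HasDegree (Multiview.criticalIdeal P Q) (c + 1) := by
    rw [hI] at hr ⊢
    exact Multiview.hasDegree_maximalMinorsIdeal hrc _ _ hr
  refine ⟨Multiview.mem_criticalLocus_iff P Q, ⟨_, hhom, hI⟩, ⟨r, hrc, hr⟩, hdeg, ?_, ?_,
    r, c, hr, hrc, hdeg⟩
  · intro f hf d
    rw [hI] at hf ⊢
    exact Multiview.homogeneousComponent_mem_maximalMinorsIdeal hhom hf d
  · intro f hf h1
    rw [hI] at hf
    exact Multiview.eq_zero_of_mem_maximalMinorsIdeal_of_isHomogeneous_one hhom hf h1
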